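/- **Setting.** Let $K\in\{2,3\}$ and $L\ge 1$. Two lattices in $\mathbb R^L$ are called similar if one is the image of the other under a scaling composed with a linear isometry. A sublattice $\Lambda'\subseteq\Lambda$ is clean if no point of $\Lambda$ lies on the boundary of a Voronoi cell of $\Lambda'$. An asymmetric design consists of: - a central lattice $\Lambda_c\subset\mathbb R^L$ with Voronoi cells of volume $\nu$; - sublattices $\Lambda_0,\dots,\Lambda_{K-1}\subseteq\Lambda_c$ of index $N_i=|\Lambda_c/\Lambda_i|$, each similar to $\Lambda_c$ and clean, with $\nu_i=N_i\nu$; - a product lattice $\Lambda_\pi\subseteq\bigcap_i\Lambda_i$, a clean sublattice of $\Lambda_c$ similar to $\Lambda_c$, of index $N_\pi=\prod_i N_i$, whose Voronoi cell around $0$ is $V_\pi(0)$; - the smallest radius $r$ such that for every $\lambda_0\in\Lambda_0\cap V_\pi(0)$ there are at least $N_0$ tuples $(\lambda_0,\lambda_1,\dots,\lambda_{K-1})$ with $\lambda_i\in\Lambda_i$ and $\|\lambda_i-\lambda_j\|\le r$ for all $i,j$; - an injective map $\alpha=(\alpha_0,\dots,\alpha_{K-1}):\Lambda_c\to\Lambda_0\times\dots\times\Lambda_{K-1}$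 with $\alpha_i(\lambda_c+\lambda_\pi)=\alpha_i(\lambda_c)+\lambda_\pi$ for $\lambda_\pi\in\Lambda_\pi$, and $\|\alpha_i(\lambda_c)-\alpha_j(\lambda_c)\|\le r$ for all $\lambda_c\in\Lambda_c$ and all $i,j$. Let $\omega_L$ be the volume of the unit ball of $\mathbb R^L$, let $\tilde\nu=\omega_Lr^L$, and let $G(S_L)=\frac{1}{L\,\omega_L^{1+2/L}}\int_{\|x\|\le1}\|x\|^2dx$ be the normalized second moment of the ball. Let the expansion factor be $$\psi_L=\left(\frac{\omega_L^{K-1}}{I_{K,L}}\right)^{\frac1{L(K-1)}},$$ where $I_{K,L}$ is the volume of the set of $(x_1,\dots,x_{K-1})\in(\mathbb R^L)^{K-1}$ such that $0,x_1,\dots,x_{K-1}$ have mutual distances at most $1$. In particular $\psi_L=1$ for $K=2$. For a pair $i\neq j$ let $\rho_{ij}$ denote the quotient of $$\frac1L\sum_{\lambda_c\in\Lambda_c\cap V_\pi(0)}\|\alpha_i(\lambda_c)-\alpha_j(\lambda_c)\|^2\qquad\text{by}\qquad \psi_L^2\,\nu^{2/L}\,G(S_L)\,N_\pi\prod_{m=0}^{K-1}N_m^{\frac{2}{L(K-1)}}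 .$$ **Proposition.** Consider sequences of designs in a fixed dimension $L$, with all central lattices similar to one fixed lattice, along which $N_i\to\infty$ and $\nu_i\to0$ for all $i$. 1. Let $K=2$. For every $L\ge 1$ and every such sequence, $\rho_{ij}\to1$ for all $i\ne j$. 2. Let $K=3$. There are constants $c_L$ with $c_L\to1$ as $L\to\infty$ such that, for every $L\ge1$ and every such sequence along which also $\nu_i/(\nu\sqrt{N_0N_1N_2})\to0$ for $i=1,2$ (that is, the number of points of $\Lambda_i$ in a ball of radius $r$ tends to infinity), $\rho_{ij}\to c_L$ for all $i\neq j$. In both cases, moreover, $\tilde\nu$ is asymptotically equal to $\psi_L^L\,\nu\prod_{m=0}^{K-1}N_m^{1/(K-1)}$, i.e. the quotient tends to $1$. -/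

import Mathlib

open MeasureTheory Filter Topology

noncomputable section

namespace MDLVQ

/-- `L`-dimensional Euclidean space. -/
abbrev Space (L : ℕ) : Type := EuclideanSpace ℝ (Fin L)

/-! ### Lattices and Voronoi cells -/

/-- The (closed) Voronoi cell of the point `s` with respect to the set of points `S`. -/
def voronoiCell {L : ℕ} (S : Set (Space L)) (s : Space L) : Set (Space L) :=
  {x | ∀ s' ∈ S, ‖x - s‖ ≤ ‖x - s'‖}

/-- `M'` is obtained from `M` by a scaling and a linear isometry (rotation, reflection). -/
def GeometricallySimilar {L : ℕ} (M M' : Submodule ℤ (Space L)) : Prop :=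
  ∃ (c : ℝ) (U : Space L ≃ₗᵢ[ℝ] Space L), 0 < c ∧
    (M' : Set (Space L)) = (fun x => c • U x) '' (M : Set (Space L))

/-- No point of `M` lies on the boundary of a Voronoi cell of `M'`. -/
def IsClean {L : ℕ} (M M' : Submodule ℤ (Space L)) : Prop :=
  ∀ x ∈ M, ∀ s ∈ M', x ∉ frontier (voronoiCell (M' : Set (Space L)) s)

/-- The index `|M / M'|` of a sublattice `M'` of `M`. -/
def latticeIndex {L : ℕ} (M M' : Submodule ℤ (Space L)) : ℕ :=
  M'.toAddSubgroup.relIndex M.toAddSubgroup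

/-! ### Spheres -/

/-- Volume of the unit ball of `ℝ^L`. -/
def unitBallVolume (L : ℕ) : ℝ :=
  (volume (Metric.closedBall (0 : Space L) 1)).toReal

/-- `G(S_L)`, the dimensionless normalized second moment `(1 / (L v^(1+2/L))) ∫_V ‖x‖² dx` of
the region `V` given by the unit ball of `ℝ^L`, `v` being the volume of `V`. -/
def sphereSecondMoment (L : ℕ) : ℝ :=
  (∫ x in Metric.closedBall (0 : Space L) 1, ‖x‖ ^ 2) /
    (L * unitBallVolume L ^ (1 + 2 / (L : ℝ)))

/-- The volume of the set of all `(x_1, …, x_{K-1})` in `(ℝ^L)^(K-1)` such that the points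
`0, x_1, …, x_{K-1}` are at mutual distances at most `1`. -/
def tupleVolume (K L : ℕ) : ℝ :=
  (volume {x : Fin (K - 1) → Space L |
    (∀ i, ‖x i‖ ≤ 1) ∧ ∀ i j, ‖x i - x j‖ ≤ 1}).toReal

/-- The dimensionless expansion factor `ψ_L` for `K` descriptions.

In the continuum limit, a ball of radius `r` around `λ_0` yields
`tupleVolume K L * r ^ (L (K-1)) / ∏_{i ≥ 1} ν_i` tuples with first coordinate `λ_0` and mutual
distances at most `r`, and all `(K-1)`-tuples of sublattice points of a ball of radius `r'`
around `λ_0` number `(unitBallVolume L * r' ^ L) ^ (K-1) / ∏_{i ≥ 1} ν_i`.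
`ψ_L` is the ratio `r / r'` of the radii for which these two numbers agree. -/
def expansionFactor (K L : ℕ) : ℝ :=
  (unitBallVolume L ^ (K - 1) / tupleVolume K L) ^ (1 / ((L : ℝ) * ((K : ℝ) - 1)))

/-! ### The asymmetric design -/

/-- The `K`-tuples `(λ_0, …, λ_{K-1})`, `λ_i` in the `i`-th sublattice, with prescribed first
coordinate `λ_0 = x` and with all mutual distances at most `r`. -/
def tuplesAt {K L : ℕ} [NeZero K] (side : Fin K → Submodule ℤ (Space L)) (r : ℝ)
    (x : Space L) : Set (Fin K → Space L) :=
  {t | t 0 = x ∧ (∀ i, t i ∈ side i) ∧ ∀ i j, ‖t i - t j‖ ≤ r}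

/-- An asymmetric `K`-description lattice quantizer in dimension `L`: a central lattice,
`K` sublattices, a product lattice, and an index assignment that uses only `K`-tuples whose
elements are at mutual distances at most `r`, where `r` is the radius of the smallest ball that
provides at least `N_0` such tuples for each `λ_0`.

Nothing is required about which of the available tuples are used (each at most once modulo the
product lattice), nor about which central lattice point gets which tuple; in particular every
solution of the final linear assignment problem is covered. -/
structure AsymmetricDesign (K L : ℕ) [NeZero K] where
  /-- the central lattice `Λ_c` -/
  central : Submodule ℤ (Space L)
  [central_discrete : DiscreteTopology central]
  [central_lattice : IsZLattice ℝ central]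
  /-- the sublattices `Λ_i` -/
  side : Fin K → Submodule ℤ (Space L)
  side_le : ∀ i, side i ≤ central
  side_similar : ∀ i, GeometricallySimilar central (side i)
  side_clean : ∀ i, IsClean central (side i)
  /-- the product lattice `Λ_π` -/
  product : Submodule ℤ (Space L)
  product_le : ∀ i, product ≤ side i
  product_similar : GeometricallySimilar central product
  product_clean : IsClean central product
  product_index : latticeIndex central product = ∏ i, latticeIndex central (side i)
  /-- the radius `r` of the ball `Ṽ` -/
  radius : ℝ
  radius_isLeast : IsLeast
    {r : ℝ | ∀ x ∈ side 0, x ∈ voronoiCell (product : Set (Space L)) 0 →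
      latticeIndex central (side 0) ≤ (tuplesAt side r x).ncard} radius
  /-- the index assignment `α = (α_0, …, α_{K-1})` -/
  label : central → Fin K → Space L
  label_mem : ∀ x i, label x i ∈ side i
  label_injective : Function.Injective label
  label_shift : ∀ x p : central, (p : Space L) ∈ product →
    ∀ i, label (x + p) i = label x i + p
  label_dist : ∀ x i j, ‖label x i - label x j‖ ≤ radius

namespace AsymmetricDesign

variable {K L : ℕ} [NeZero K]

/-- `N_i`, the index of the `i`-th sublattice. -/
def index (d : AsymmetricDesign K L) (i : Fin K) : ℕ :=
  latticeIndex d.central (d.side i)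

/-- `N_π`, the index of the product lattice. -/
def productIndex (d : AsymmetricDesign K L) : ℕ :=
  latticeIndex d.central d.product

/-- `ν`, the volume of a Voronoi cell of the central lattice. -/
def cellVolume (d : AsymmetricDesign K L) : ℝ :=
  ZLattice.covolume d.central

/-- `ν_i = N_i ν`, the volume of a Voronoi cell of the `i`-th sublattice. -/
def sideCellVolume (d : AsymmetricDesign K L) (i : Fin K) : ℝ :=
  d.index i * d.cellVolume

/-- The volume of the ball `Ṽ`. -/
def ballVolume (d : AsymmetricDesign K L) : ℝ :=
  unitBallVolume L * d.radius ^ L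

/-- `(1/L) ∑_{λ_c ∈ V_π(0)} ‖α_i(λ_c) - α_j(λ_c)‖²`. -/
def pairDistortion (d : AsymmetricDesign K L) (i j : Fin K) : ℝ :=
  1 / (L : ℝ) *
    ∑ᶠ x : {x : d.central // (x : Space L) ∈ voronoiCell (d.product : Set (Space L)) 0},
      ‖d.label x.1 i - d.label x.1 j‖ ^ 2

/-- `ψ_L² ν^(2/L) G(S_L) N_π ∏_m N_m^(2/(L(K-1)))`. -/
def predictedDistortion (d : AsymmetricDesign K L) : ℝ :=
  expansionFactor K L ^ 2 * d.cellVolume ^ (2 / (L : ℝ)) * sphereSecondMoment L *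
    d.productIndex * ∏ m, (d.index m : ℝ) ^ (2 / ((L : ℝ) * ((K : ℝ) - 1)))

/-- `ψ_L^L ν ∏_m N_m^(1/(K-1))`. -/
def predictedBallVolume (d : AsymmetricDesign K L) : ℝ :=
  expansionFactor K L ^ L * d.cellVolume * ∏ m, (d.index m : ℝ) ^ (1 / ((K : ℝ) - 1))

end AsymmetricDesign

/-- A sequence of designs whose central lattices are all similar to the fixed lattice `M`, such
that `N_i → ∞` and `ν_i → 0` for all `i`. -/
structure HighResolution {K L : ℕ} [NeZero K] (M : Submodule ℤ (Space L))
    (d : ℕ → AsymmetricDesign K L) : Prop where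
  similar : ∀ n, GeometricallySimilar M (d n).central
  index_tendsto : ∀ i, Tendsto (fun n => (d n).index i) atTop atTop
  volume_tendsto : ∀ i, Tendsto (fun n => (d n).sideCellVolume i) atTop (𝓝 0)

/-- `ν_i / (ν ∏_m N_m^(1/(K-1))) → 0` for `i = 1, …, K-1`: up to the constant `ψ_L^L`, the
denominator is the volume of `Ṽ`, so this says that the number of points of the `i`-th sublattice
in the balls around the points `λ_0` tends to infinity. It is automatic for `K = 2`, where the
quotient is `1 / N_0`. -/
def FillsBalls {K L : ℕ} [NeZero K] (d : ℕ → AsymmetricDesign K L) : Prop :=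
  ∀ i, i ≠ 0 → Tendsto
    (fun n => ((d n).index i : ℝ) / ∏ m, ((d n).index m : ℝ) ^ (1 / ((K : ℝ) - 1)))
    atTop (𝓝 0)

end MDLVQ

end

/-! Let K = k + 1. Fix λ₀ and attach to every admissible tuple the product of translated fundamental
domains of Λ₁, …, Λ_k, seen from λ₀ (`tupleCell`). These cells are disjoint, have the common volume
∏_{i≥1} ν_i, and change mutual distances by at most 2ρ', where ρ' bounds the radii of the tiles. So
they lie in the body of configurations of diameter at most r + 2ρ' and cover the one for r − 2ρ'. If
ρ'/r → 0, then, uniformly in λ₀, the number of tuples is asymptotic to r^(kL) I / ∏ν_i and the sum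
of their squared (i,j)-distances to r^(kL+2) J_ij / ∏ν_i, with I = `bodyVolume` and J_ij =
`bodyMoment` (`card_tuplesAt_le`, `le_card_tuplesAt`, `sum_tuplesAt_le`, `le_sum_tuplesAt`).

Minimality of r forces the number of tuples to be asymptotic to N₀, which is the claim on the volume
of the ball (`fillRatio_bounds`, `ballVolume_div_pow`). The choice of labels is irrelevant: modulo
Λ_π the labels are N_π distinct tuples with λ₀ ∈ V_π(0); there are N_π/N₀ such λ₀, each with (1 +
o(1))N₀ tuples, so only o(N_π) available tuples are unused, each worth at most r²
(`exists_usedTuples`, `labelSum_bounds`). Hence the mean squared distance is asymptotic to r²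
J_ij/I, and ρ_ij tends to (J_ij/I) · ω_L/∫‖x‖².

That tiles are small compared with r is deduced from N₀ ≤ ∏ C(1 + X_i), where X_i is proportional to
r^L/ν_i. One factor must tend to infinity with N₀; for two factors the filling hypothesis prevents
one from staying bounded (`exists_smallTiles`, `tendsto_atTop_of_le_mul`).

For K = 2 the limit is 1 because J/I is the mean of ‖x‖² over the ball. For K = 3 the three moments
agree by symmetry, and J/I → 1 as L → ∞ because triangles with a side shorter than a fixed s < 1
become negligible (`tendsto_pairBody_fraction`); the ball behaves likewise. -/

open MeasureTheory Filter Topology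

noncomputable section

namespace MDLVQ

/-! ### The body of admissible configurations -/

/-- The configuration `0, x_1, …, x_k`. -/
def withOrigin {k L : ℕ} (x : Fin k → Space L) : Fin (k + 1) → Space L := Fin.cons 0 x

@[simp] lemma withOrigin_zero {k L : ℕ} (x : Fin k → Space L) : withOrigin x 0 = 0 := rfl

@[simp] lemma withOrigin_succ {k L : ℕ} (x : Fin k → Space L) (i : Fin k) :
    withOrigin x i.succ = x i := rfl

lemma withOrigin_smul {k L : ℕ} (c : ℝ) (x : Fin k → Space L) (i : Fin (k + 1)) :
    withOrigin (c • x) i = c • withOrigin x i := by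
  refine Fin.cases ?_ (fun i => ?_) i <;> simp

lemma continuous_withOrigin {k L : ℕ} (i : Fin (k + 1)) :
    Continuous fun x : Fin k → Space L => withOrigin x i := by
  refine Fin.cases ?_ (fun i => ?_) i
  · simpa using continuous_const
  · simpa using continuous_apply i

lemma continuous_withOrigin_sub {k L : ℕ} (i j : Fin (k + 1)) :
    Continuous fun x : Fin k → Space L => ‖withOrigin x i - withOrigin x j‖ :=
  ((continuous_withOrigin i).sub (continuous_withOrigin j)).norm

/-- The set of `(x_1, …, x_k)` such that `0, x_1, …, x_k` have mutual distances at most `r`. -/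
def tupleBody (k L : ℕ) (r : ℝ) : Set (Fin k → Space L) :=
  {x | ∀ i j, ‖withOrigin x i - withOrigin x j‖ ≤ r}

lemma norm_le_of_mem_tupleBody {k L : ℕ} {r : ℝ} {x : Fin k → Space L}
    (hx : x ∈ tupleBody k L r) (i : Fin k) : ‖x i‖ ≤ r := by
  simpa using hx i.succ 0

lemma mem_tupleBody_iff {k L : ℕ} {r : ℝ} (hr : 0 ≤ r) {x : Fin k → Space L} :
    x ∈ tupleBody k L r ↔ (∀ i, ‖x i‖ ≤ r) ∧ ∀ i j, ‖x i - x j‖ ≤ r := by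
  constructor
  · intro h
    exact ⟨norm_le_of_mem_tupleBody h, fun i j => by simpa using h i.succ j.succ⟩
  · rintro ⟨h1, h2⟩ i j
    refine Fin.cases ?_ (fun i => ?_) i <;> refine Fin.cases ?_ (fun j => ?_) j
    · simpa using hr
    · simpa using h1 j
    · simpa using h1 i
    · simpa using h2 i j

lemma isCompact_tupleBody (k L : ℕ) (r : ℝ) : IsCompact (tupleBody k L r) := by
  apply Metric.isCompact_of_isClosed_isBounded
  · simp only [tupleBody, Set.ofPred_forall]
    exact isClosed_iInter fun i => isClosed_iInter fun j =>
      isClosed_le (continuous_withOrigin_sub i j) continuous_const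
  · refine (Metric.isBounded_closedBall (x := (0 : Fin k → Space L)) (r := max r 0)).subset ?_
    intro x hx
    rw [mem_closedBall_zero_iff, pi_norm_le_iff_of_nonneg (le_max_right _ _)]
    exact fun i => (norm_le_of_mem_tupleBody hx i).trans (le_max_left _ _)

lemma measurableSet_tupleBody (k L : ℕ) (r : ℝ) : MeasurableSet (tupleBody k L r) :=
  (isCompact_tupleBody k L r).measurableSet

/-- The volume of the body of configurations with mutual distances at most `1`. -/
def bodyVolume (k L : ℕ) : ℝ := volume.real (tupleBody k L 1)

/-- The integral of a squared mutual distance over the body of configurations. -/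
def bodyMoment (k L : ℕ) (i j : Fin (k + 1)) : ℝ :=
  ∫ x in tupleBody k L 1, ‖withOrigin x i - withOrigin x j‖ ^ 2

lemma tupleVolume_eq (k L : ℕ) : tupleVolume (k + 1) L = bodyVolume k L := by
  unfold tupleVolume bodyVolume Measure.real
  congr 2
  ext x
  rw [mem_tupleBody_iff zero_le_one]
  rfl

lemma bodyVolume_pos (k L : ℕ) : 0 < bodyVolume k L := by
  refine ENNReal.toReal_pos ?_ (isCompact_tupleBody k L 1).measure_lt_top.ne
  refine (lt_of_lt_of_le (Metric.measure_ball_pos volume (0 : Fin k → Space L)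
    (by norm_num : (0:ℝ) < 1 / 2)) (measure_mono ?_)).ne'
  intro x hx
  rw [mem_ball_zero_iff] at hx
  have hi : ∀ i, ‖x i‖ ≤ 1 / 2 := fun i => (norm_le_pi_norm x i).trans hx.le
  rw [mem_tupleBody_iff zero_le_one]
  exact ⟨fun i => (hi i).trans (by norm_num), fun i j =>
    (norm_sub_le _ _).trans (by linarith [hi i, hi j])⟩

lemma finrank_tuples (k L : ℕ) : Module.finrank ℝ (Fin k → Space L) = k * L := by
  rw [Module.finrank_pi_fintype]
  simp

open scoped Pointwise in
lemma smul_tupleBody (k L : ℕ) {r : ℝ} (hr : 0 < r) :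
    r • tupleBody k L 1 = tupleBody k L r := by
  ext x
  rw [Set.mem_smul_set_iff_inv_smul_mem₀ hr.ne']
  simp only [tupleBody, Set.mem_ofPred_eq, withOrigin_smul, ← smul_sub, norm_smul, norm_inv,
    Real.norm_of_nonneg hr.le, inv_mul_le_iff₀ hr, mul_one]

open scoped Pointwise in
lemma volume_tupleBody (k L : ℕ) {r : ℝ} (hr : 0 < r) :
    volume.real (tupleBody k L r) = r ^ (k * L) * bodyVolume k L := by
  rw [← smul_tupleBody k L hr, Measure.real, Measure.addHaar_smul, finrank_tuples,
    ENNReal.toReal_mul, ENNReal.toReal_ofReal (abs_nonneg _), abs_of_pos (pow_pos hr _)]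
  rfl

open scoped Pointwise in
lemma integral_tupleBody (k L : ℕ) {r : ℝ} (hr : 0 < r) (i j : Fin (k + 1)) :
    ∫ x in tupleBody k L r, ‖withOrigin x i - withOrigin x j‖ ^ 2 =
      r ^ (k * L + 2) * bodyMoment k L i j := by
  have h := Measure.setIntegral_comp_smul_of_pos volume
    (fun x : Fin k → Space L => ‖withOrigin x i - withOrigin x j‖ ^ 2) (tupleBody k L 1) hr
  rw [smul_tupleBody k L hr, finrank_tuples] at h
  simp only [withOrigin_smul, ← smul_sub, norm_smul, mul_pow, Real.norm_of_nonneg hr.le,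
    integral_const_mul, smul_eq_mul] at h
  rw [eq_inv_mul_iff_mul_eq₀ (pow_pos hr _).ne'] at h
  rw [← h, bodyMoment]
  ring

lemma bodyMoment_le (k L : ℕ) (i j : Fin (k + 1)) : bodyMoment k L i j ≤ bodyVolume k L := by
  have h := setIntegral_mono_on (μ := volume) (s := tupleBody k L 1)
    (f := fun x => ‖withOrigin x i - withOrigin x j‖ ^ 2) (g := fun _ => (1:ℝ))
    (((continuous_withOrigin_sub i j).pow 2).continuousOn.integrableOn_compact
      (isCompact_tupleBody k L 1))
    (integrableOn_const (isCompact_tupleBody k L 1).measure_lt_top.ne)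
    (measurableSet_tupleBody k L 1) (fun x hx => pow_le_one₀ (norm_nonneg _) (hx i j))
  simpa [bodyMoment, bodyVolume] using h

/-! ### Counting by comparison of sums with integrals over cells -/

section Cells

variable {α E : Type*} [MeasurableSpace E] {μ : Measure E} {S : Finset α} {cell : α → Set E}
  {v : ℝ} {B : Set E} {g : α → ℝ} {G : E → ℝ}

/-- The sum is the integral of a step function lying below `G`; nonnegativity of `G` accounts for
the part of `B` that no cell covers. -/
lemma sum_mul_le_setIntegral (hm : ∀ t ∈ S, MeasurableSet (cell t))
    (hd : (S : Set α).PairwiseDisjoint cell) (hv : ∀ t ∈ S, μ.real (cell t) = v)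
    (hfin : ∀ t ∈ S, μ (cell t) ≠ ⊤) (hB : MeasurableSet B) (hG : IntegrableOn G B μ)
    (hG0 : ∀ x ∈ B, 0 ≤ G x) (hsub : ∀ t ∈ S, cell t ⊆ B)
    (hle : ∀ t ∈ S, ∀ x ∈ cell t, g t ≤ G x) :
    v * ∑ t ∈ S, g t ≤ ∫ x in B, G x ∂μ := by
  calc v * ∑ t ∈ S, g t = ∑ t ∈ S, ∫ _ in cell t, g t ∂μ := by
        rw [Finset.mul_sum]
        refine Finset.sum_congr rfl fun t ht => ?_
        rw [setIntegral_const, hv t ht, smul_eq_mul]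
    _ ≤ ∑ t ∈ S, ∫ x in cell t, G x ∂μ := Finset.sum_le_sum fun t ht =>
        setIntegral_mono_on (integrableOn_const (hfin t ht)) (hG.mono_set (hsub t ht)) (hm t ht)
          (hle t ht)
    _ = ∫ x in ⋃ t ∈ S, cell t, G x ∂μ :=
        (integral_biUnion_finset S hm hd fun t ht => hG.mono_set (hsub t ht)).symm
    _ ≤ ∫ x in B, G x ∂μ := setIntegral_mono_set hG
        ((ae_restrict_iff' hB).2 (Eventually.of_forall hG0))
        (Set.iUnion₂_subset hsub).eventuallyLE

/-- Cells may stick out of `B`, so each is cut down to `cell t ∩ B`, and `g ≥ 0` absorbs the lost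
volume. `G` may be negative, which later allows a constant to be subtracted from it. -/
lemma setIntegral_le_sum_mul (hm : ∀ t ∈ S, MeasurableSet (cell t))
    (hd : (S : Set α).PairwiseDisjoint cell) (hv : ∀ t ∈ S, μ.real (cell t) = v)
    (hfin : ∀ t ∈ S, μ (cell t) ≠ ⊤) (hB : MeasurableSet B) (hG : IntegrableOn G B μ)
    (hg0 : ∀ t ∈ S, 0 ≤ g t) (hsub : B ⊆ ⋃ t ∈ S, cell t)
    (hle : ∀ t ∈ S, ∀ x ∈ cell t, x ∈ B → G x ≤ g t) :
    ∫ x in B, G x ∂μ ≤ v * ∑ t ∈ S, g t := by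
  have hBeq : B = ⋃ t ∈ S, cell t ∩ B := by
    ext x
    constructor
    · intro hx
      obtain ⟨t, ht, hxt⟩ := Set.mem_iUnion₂.1 (hsub hx)
      exact Set.mem_iUnion₂.2 ⟨t, ht, hxt, hx⟩
    · intro hx
      obtain ⟨t, ht, hxt⟩ := Set.mem_iUnion₂.1 hx
      exact hxt.2
  have hfin' : ∀ t ∈ S, μ (cell t ∩ B) ≠ ⊤ := fun t ht =>
    ((measure_mono Set.inter_subset_left).trans_lt (hfin t ht).lt_top).ne
  calc ∫ x in B, G x ∂μ = ∫ x in ⋃ t ∈ S, cell t ∩ B, G x ∂μ := by rw [← hBeq]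
    _ = ∑ t ∈ S, ∫ x in cell t ∩ B, G x ∂μ :=
        integral_biUnion_finset S (fun t ht => (hm t ht).inter hB)
          (fun a ha b hb hab => (hd ha hb hab).mono Set.inter_subset_left Set.inter_subset_left)
          fun t _ => hG.mono_set Set.inter_subset_right
    _ ≤ ∑ t ∈ S, ∫ _ in cell t ∩ B, g t ∂μ := Finset.sum_le_sum fun t ht =>
        setIntegral_mono_on (hG.mono_set Set.inter_subset_right)
          (integrableOn_const (hfin' t ht)) ((hm t ht).inter hB)
          fun x hx => hle t ht x hx.1 hx.2
    _ ≤ v * ∑ t ∈ S, g t := by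
        rw [Finset.mul_sum]
        refine Finset.sum_le_sum fun t ht => ?_
        rw [setIntegral_const, smul_eq_mul]
        refine mul_le_mul_of_nonneg_right ?_ (hg0 t ht)
        rw [← hv t ht]
        exact measureReal_mono Set.inter_subset_left (hfin t ht)

end Cells

/-- `F` is a bounded measurable set whose translates by `Λ` tile the space. -/
structure IsTile {L : ℕ} (Λ : Submodule ℤ (Space L)) (F : Set (Space L)) (ρ : ℝ) : Prop where
  measurable : MeasurableSet F
  volume_pos : 0 < volume.real F
  norm_le : ∀ y ∈ F, ‖y‖ ≤ ρ
  cover : ∀ y, ∃ a ∈ Λ, y - a ∈ F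
  unique : ∀ y, ∀ a ∈ Λ, ∀ b ∈ Λ, y - a ∈ F → y - b ∈ F → a = b

lemma IsTile.nonneg {L : ℕ} {Λ : Submodule ℤ (Space L)} {F : Set (Space L)} {ρ : ℝ}
    (h : IsTile Λ F ρ) : 0 ≤ ρ := by
  obtain ⟨a, -, ha⟩ := h.cover 0
  exact (norm_nonneg _).trans (h.norm_le _ ha)

/-! ### Counting the tuples around one point by product cells. -/

section Tuples

variable {k L : ℕ} {side : Fin (k + 1) → Submodule ℤ (Space L)} {F : Fin k → Set (Space L)}
  {ρ : Fin k → ℝ}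

/-- The product of translated tiles around the tuple `t`, seen from `x₀`. -/
def tupleCell (F : Fin k → Set (Space L)) (x₀ : Space L) (t : Fin (k + 1) → Space L) :
    Set (Fin k → Space L) :=
  {x | ∀ i, x i + x₀ - t i.succ ∈ F i}

lemma tupleCell_eq (F : Fin k → Set (Space L)) (x₀ : Space L) (t : Fin (k + 1) → Space L) :
    tupleCell F x₀ t = (fun x => x + fun i => x₀ - t i.succ) ⁻¹' Set.univ.pi F := by
  ext x
  simp [tupleCell, Set.mem_pi, add_sub_assoc]

lemma measurableSet_tupleCell (hF : ∀ i, IsTile (side i.succ) (F i) (ρ i)) (x₀ : Space L)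
    (t : Fin (k + 1) → Space L) : MeasurableSet (tupleCell F x₀ t) := by
  rw [tupleCell_eq]
  exact (MeasurableSet.univ_pi fun i => (hF i).measurable).preimage (measurable_add_const _)

lemma volume_tupleCell (F : Fin k → Set (Space L)) (x₀ : Space L) (t : Fin (k + 1) → Space L) :
    volume.real (tupleCell F x₀ t) = ∏ i, volume.real (F i) := by
  rw [tupleCell_eq, Measure.real, measure_preimage_add_right, volume_pi_pi, ENNReal.toReal_prod]
  rfl

lemma volume_tupleCell_ne_top (hF : ∀ i, IsTile (side i.succ) (F i) (ρ i)) (x₀ : Space L)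
    (t : Fin (k + 1) → Space L) : volume (tupleCell F x₀ t) ≠ ⊤ := by
  intro h
  have h1 := volume_tupleCell F x₀ t
  rw [Measure.real, h, ENNReal.toReal_top] at h1
  exact (Finset.prod_pos fun i _ => (hF i).volume_pos).ne h1

lemma disjoint_tupleCell (hF : ∀ i, IsTile (side i.succ) (F i) (ρ i)) {x₀ : Space L} {r : ℝ}
    {s t : Fin (k + 1) → Space L} (hs : s ∈ tuplesAt side r x₀) (ht : t ∈ tuplesAt side r x₀)
    (hst : s ≠ t) : Disjoint (tupleCell F x₀ s) (tupleCell F x₀ t) := by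
  rw [Set.disjoint_left]
  intro x hxs hxt
  apply hst
  ext1 i
  refine Fin.cases ?_ (fun i => ?_) i
  · rw [hs.1, ht.1]
  · exact (hF i).unique _ _ (hs.2.1 _) _ (ht.2.1 _) (hxs i) (hxt i)

lemma norm_sub_of_mem_tupleCell {ρ : ℝ} (hρ : 0 ≤ ρ)
    (hF : ∀ i, ∀ y ∈ F i, ‖y‖ ≤ ρ) {x₀ : Space L} {t : Fin (k + 1) → Space L} (h0 : t 0 = x₀)
    {x : Fin k → Space L} (hx : x ∈ tupleCell F x₀ t) (i : Fin (k + 1)) :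
    ‖withOrigin x i - (t i - x₀)‖ ≤ ρ := by
  refine Fin.cases ?_ (fun i => ?_) i
  · simpa [h0] using hρ
  · rw [withOrigin_succ, sub_sub_eq_add_sub]
    exact hF i _ (hx i)

/-- Within a cell every vertex moves by at most ρ. This is the only metric error in all the counts
below. -/
lemma abs_dist_sub_of_mem_tupleCell {ρ : ℝ} (hρ : 0 ≤ ρ)
    (hF : ∀ i, ∀ y ∈ F i, ‖y‖ ≤ ρ) {x₀ : Space L} {t : Fin (k + 1) → Space L} (h0 : t 0 = x₀)
    {x : Fin k → Space L} (hx : x ∈ tupleCell F x₀ t) (i j : Fin (k + 1)) :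
    |‖withOrigin x i - withOrigin x j‖ - ‖t i - t j‖| ≤ 2 * ρ := by
  refine (abs_norm_sub_norm_le _ _).trans ?_
  have h : withOrigin x i - withOrigin x j - (t i - t j) =
      (withOrigin x i - (t i - x₀)) - (withOrigin x j - (t j - x₀)) := by abel
  rw [h]
  refine (norm_sub_le _ _).trans ?_
  linarith [norm_sub_of_mem_tupleCell hρ hF h0 hx i, norm_sub_of_mem_tupleCell hρ hF h0 hx j]

lemma tupleCell_subset {ρ : ℝ} (hρ : 0 ≤ ρ) (hF : ∀ i, ∀ y ∈ F i, ‖y‖ ≤ ρ) {x₀ : Space L} {r : ℝ}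
    {t : Fin (k + 1) → Space L} (ht : t ∈ tuplesAt side r x₀) :
    tupleCell F x₀ t ⊆ tupleBody k L (r + 2 * ρ) := by
  intro x hx i j
  have := abs_le.1 (abs_dist_sub_of_mem_tupleCell hρ hF ht.1 hx i j)
  linarith [ht.2.2 i j]

lemma exists_mem_tupleCell (hF : ∀ i, IsTile (side i.succ) (F i) (ρ i)) {x₀ : Space L}
    (hx₀ : x₀ ∈ side 0) {ρ' r : ℝ} (hρ : 0 ≤ ρ') (hρ' : ∀ i, ρ i ≤ ρ') {x : Fin k → Space L}
    (hx : x ∈ tupleBody k L (r - 2 * ρ')) :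
    ∃ t ∈ tuplesAt side r x₀, x ∈ tupleCell F x₀ t := by
  choose a ha haF using fun i => (hF i).cover (x i + x₀)
  obtain ⟨t, h0, hs⟩ : ∃ t : Fin (k + 1) → Space L, t 0 = x₀ ∧ ∀ i : Fin k, t i.succ = a i :=
    ⟨Fin.cons x₀ a, rfl, fun _ => rfl⟩
  have hcell : x ∈ tupleCell F x₀ t := fun i => by simpa [hs i] using haF i
  refine ⟨t, ⟨h0, fun i => ?_, fun i j => ?_⟩, hcell⟩
  · refine Fin.cases ?_ (fun i => ?_) i
    · rwa [h0]
    · rw [hs i]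
      exact ha i
  · have := abs_le.1 (abs_dist_sub_of_mem_tupleCell hρ
      (fun i y hy => ((hF i).norm_le y hy).trans (hρ' i)) h0 hcell i j)
    linarith [hx i j]

lemma card_mul_le_of_subset (hF : ∀ i, IsTile (side i.succ) (F i) (ρ i)) {x₀ : Space L} {r : ℝ}
    {S : Finset (Fin (k + 1) → Space L)} (hS : ↑S ⊆ tuplesAt side r x₀) {B : Set (Fin k → Space L)}
    (hB : MeasurableSet B) (hBfin : volume B ≠ ⊤)
    (hsub : ∀ t ∈ tuplesAt side r x₀, tupleCell F x₀ t ⊆ B) :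
    (∏ i, volume.real (F i)) * (S.card : ℝ) ≤ volume.real B := by
  have h := sum_mul_le_setIntegral (μ := volume) (S := S) (cell := tupleCell F x₀)
    (v := ∏ i, volume.real (F i)) (B := B) (g := fun _ => 1) (G := fun _ => 1)
    (fun t _ => measurableSet_tupleCell hF x₀ t)
    (fun s hs t ht hst => disjoint_tupleCell hF (hS hs) (hS ht) hst)
    (fun t _ => volume_tupleCell F x₀ t) (fun t _ => volume_tupleCell_ne_top hF x₀ t) hB
    (integrableOn_const hBfin) (fun _ _ => zero_le_one) (fun t ht => hsub t (hS ht))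
    (fun _ _ _ _ => le_rfl)
  simpa using h

/-- `Set.ncard` vanishes on infinite sets, so the counts are meaningful only after this. An infinite
family would contain arbitrarily many disjoint cells of one fixed volume inside a bounded body. -/
lemma finite_tuplesAt (hF : ∀ i, IsTile (side i.succ) (F i) (ρ i)) (r : ℝ) (x₀ : Space L) :
    (tuplesAt side r x₀).Finite := by
  by_contra hinf
  have hV : 0 < ∏ i, volume.real (F i) := Finset.prod_pos fun i _ => (hF i).volume_pos
  set ρ' := ∑ i, ρ i
  have hρ' : 0 ≤ ρ' := Finset.sum_nonneg fun i _ => (hF i).nonneg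
  have hle : ∀ i, ρ i ≤ ρ' := fun i =>
    Finset.single_le_sum (f := ρ) (fun i _ => (hF i).nonneg) (Finset.mem_univ i)
  obtain ⟨n, hn⟩ := exists_nat_gt
    (volume.real (tupleBody k L (r + 2 * ρ')) / ∏ i, volume.real (F i))
  obtain ⟨S, hS, hcard⟩ := Set.Infinite.exists_subset_card_eq hinf n
  have := card_mul_le_of_subset hF hS (measurableSet_tupleBody k L (r + 2 * ρ'))
    (isCompact_tupleBody k L _).measure_lt_top.ne
    (fun t ht => tupleCell_subset hρ' (fun i y hy => ((hF i).norm_le y hy).trans (hle i)) ht)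
  rw [div_lt_iff₀ hV, ← hcard] at hn
  linarith

lemma card_tuplesAt_le_of_subset (hF : ∀ i, IsTile (side i.succ) (F i) (ρ i)) {x₀ : Space L}
    {r : ℝ} {B : Set (Fin k → Space L)} (hB : MeasurableSet B) (hBfin : volume B ≠ ⊤)
    (hsub : ∀ t ∈ tuplesAt side r x₀, tupleCell F x₀ t ⊆ B) :
    (∏ i, volume.real (F i)) * ((tuplesAt side r x₀).ncard : ℝ) ≤ volume.real B := by
  rw [Set.ncard_eq_toFinset_card _ (finite_tuplesAt hF r x₀)]
  exact card_mul_le_of_subset hF (by simp) hB hBfin hsub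

/-- A crude bound that forgets the distances among the nonzero vertices but keeps each tile radius
separate. It is meant for the stage at which the tiles are not yet known to be small compared with
`r`. -/
lemma card_tuplesAt_le_prod (hF : ∀ i, IsTile (side i.succ) (F i) (ρ i)) (x₀ : Space L)
    {r : ℝ} (hr : 0 ≤ r) :
    (∏ i, volume.real (F i)) * ((tuplesAt side r x₀).ncard : ℝ) ≤
      ∏ i, (r + ρ i) ^ L * unitBallVolume L := by
  have hvol : volume (Set.univ.pi fun i => Metric.closedBall (0 : Space L) (r + ρ i)) =
      ∏ i, volume (Metric.closedBall (0 : Space L) (r + ρ i)) := volume_pi_pi _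
  refine (card_tuplesAt_le_of_subset hF
    (B := Set.univ.pi fun i => Metric.closedBall (0 : Space L) (r + ρ i))
    (MeasurableSet.univ_pi fun i => measurableSet_closedBall) ?_ ?_).trans_eq ?_
  · rw [hvol]
    exact ENNReal.prod_ne_top fun i _ => measure_closedBall_lt_top.ne
  · intro t ht x hx i _
    rw [mem_closedBall_zero_iff]
    have h1 := (hF i).norm_le _ (hx i)
    have h2 := ht.2.2 i.succ 0
    rw [ht.1] at h2
    have h3 : x i = (x i + x₀ - t i.succ) + (t i.succ - x₀) := by abel
    rw [h3]
    exact (norm_add_le _ _).trans (by linarith)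
  · rw [Measure.real, hvol, ENNReal.toReal_prod]
    refine Finset.prod_congr rfl fun i _ => ?_
    rw [Measure.addHaar_closedBall' _ _ (add_nonneg hr (hF i).nonneg), ENNReal.toReal_mul,
      ENNReal.toReal_ofReal (pow_nonneg (add_nonneg hr (hF i).nonneg) _)]
    simp [unitBallVolume]

variable {ρ' : ℝ}

lemma card_tuplesAt_le (hF : ∀ i, IsTile (side i.succ) (F i) (ρ i)) (x₀ : Space L) {r : ℝ}
    (hr : 0 < r) (hρ : 0 ≤ ρ') (hρ' : ∀ i, ρ i ≤ ρ') :
    (∏ i, volume.real (F i)) * ((tuplesAt side r x₀).ncard : ℝ) ≤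
      (r + 2 * ρ') ^ (k * L) * bodyVolume k L := by
  rw [← volume_tupleBody k L (by linarith)]
  exact card_tuplesAt_le_of_subset hF (measurableSet_tupleBody k L _)
    (isCompact_tupleBody k L _).measure_lt_top.ne
    (fun t ht => tupleCell_subset hρ (fun i y hy => ((hF i).norm_le y hy).trans (hρ' i)) ht)

lemma setIntegral_le_sum_tuplesAt (hF : ∀ i, IsTile (side i.succ) (F i) (ρ i)) {x₀ : Space L}
    (hx₀ : x₀ ∈ side 0) {r : ℝ} (hρ : 0 ≤ ρ') (hρ' : ∀ i, ρ i ≤ ρ')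
    {g : (Fin (k + 1) → Space L) → ℝ} {G : (Fin k → Space L) → ℝ} (hg : ∀ t, 0 ≤ g t)
    (hG : Continuous G) (hle : ∀ t ∈ tuplesAt side r x₀, ∀ x ∈ tupleCell F x₀ t,
      x ∈ tupleBody k L (r - 2 * ρ') → G x ≤ g t) :
    ∫ x in tupleBody k L (r - 2 * ρ'), G x ≤
      (∏ i, volume.real (F i)) * ∑ t ∈ (finite_tuplesAt hF r x₀).toFinset, g t := by
  refine setIntegral_le_sum_mul (cell := tupleCell F x₀)
    (fun t _ => measurableSet_tupleCell hF x₀ t)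
    (fun s hs t ht hst => disjoint_tupleCell hF (by simpa using hs) (by simpa using ht) hst)
    (fun t _ => volume_tupleCell F x₀ t) (fun t _ => volume_tupleCell_ne_top hF x₀ t)
    (measurableSet_tupleBody k L _)
    (hG.continuousOn.integrableOn_compact (isCompact_tupleBody k L _)) (fun t _ => hg t) ?_
    (fun t ht => hle t (by simpa using ht))
  intro x hx
  obtain ⟨t, ht, hxt⟩ := exists_mem_tupleCell hF hx₀ hρ hρ' hx
  exact Set.mem_iUnion₂.2 ⟨t, by simpa using ht, hxt⟩

lemma le_card_tuplesAt (hF : ∀ i, IsTile (side i.succ) (F i) (ρ i)) {x₀ : Space L}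
    (hx₀ : x₀ ∈ side 0) {r : ℝ} (hρ : 0 ≤ ρ') (hρ' : ∀ i, ρ i ≤ ρ') (hr : 2 * ρ' < r) :
    (r - 2 * ρ') ^ (k * L) * bodyVolume k L ≤
      (∏ i, volume.real (F i)) * ((tuplesAt side r x₀).ncard : ℝ) := by
  rw [← volume_tupleBody k L (by linarith)]
  have h := setIntegral_le_sum_tuplesAt hF hx₀ (r := r) hρ hρ' (g := fun _ => 1)
    (G := fun _ => 1) (fun _ => zero_le_one) continuous_const (fun _ _ _ _ _ => le_rfl)
  rw [Set.ncard_eq_toFinset_card _ (finite_tuplesAt hF r x₀)]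
  simpa using h

lemma sum_tuplesAt_le (hF : ∀ i, IsTile (side i.succ) (F i) (ρ i)) (x₀ : Space L) {r : ℝ}
    (hr : 0 < r) (hρ : 0 ≤ ρ') (hρ' : ∀ i, ρ i ≤ ρ') (i j : Fin (k + 1)) :
    (∏ i, volume.real (F i)) *
        ∑ t ∈ (finite_tuplesAt hF r x₀).toFinset, ‖t i - t j‖ ^ 2 ≤
      (r + 2 * ρ') ^ (k * L + 2) * bodyMoment k L i j +
        (4 * ρ' * (r + 2 * ρ') + 4 * ρ' ^ 2) * ((r + 2 * ρ') ^ (k * L) * bodyVolume k L) := by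
  have hb : ∀ i, ∀ y ∈ F i, ‖y‖ ≤ ρ' := fun i y hy => ((hF i).norm_le y hy).trans (hρ' i)
  -- With a the distance in the body, (a + 2ρ')² = a² + 4ρ'a + 4ρ'² and a ≤ r + 2ρ'.
  set c := 4 * ρ' * (r + 2 * ρ') + 4 * ρ' ^ 2 with hc
  have hc0 : 0 ≤ c := by positivity
  have hcont : Continuous fun x : Fin k → Space L => ‖withOrigin x i - withOrigin x j‖ ^ 2 :=
    (continuous_withOrigin_sub i j).pow 2
  have hK := isCompact_tupleBody k L (r + 2 * ρ')
  have h := sum_mul_le_setIntegral (μ := volume) (S := (finite_tuplesAt hF r x₀).toFinset)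
    (cell := tupleCell F x₀)
    (v := ∏ i, volume.real (F i)) (B := tupleBody k L (r + 2 * ρ'))
    (g := fun t => ‖t i - t j‖ ^ 2)
    (G := fun x => ‖withOrigin x i - withOrigin x j‖ ^ 2 + c)
    (fun t _ => measurableSet_tupleCell hF x₀ t)
    (fun s hs t ht hst => disjoint_tupleCell hF (by simpa using hs) (by simpa using ht) hst)
    (fun t _ => volume_tupleCell F x₀ t) (fun t _ => volume_tupleCell_ne_top hF x₀ t)
    (measurableSet_tupleBody k L _)
    ((hcont.add continuous_const).continuousOn.integrableOn_compact hK)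
    (fun x _ => by positivity)
    (fun t ht => tupleCell_subset hρ hb (by simpa using ht)) ?_
  · rw [integral_add (hcont.continuousOn.integrableOn_compact hK)
      (integrableOn_const hK.measure_lt_top.ne), integral_tupleBody k L (by linarith),
      setIntegral_const, volume_tupleBody k L (by linarith), smul_eq_mul, mul_comm _ c] at h
    exact h
  · intro t ht x hx
    have ht' : t ∈ tuplesAt side r x₀ := by simpa using ht
    have h1 := abs_le.1 (abs_dist_sub_of_mem_tupleCell hρ hb ht'.1 hx i j)
    have h2 := tupleCell_subset hρ hb ht' hx i j
    have h3 : ‖t i - t j‖ ^ 2 ≤ (‖withOrigin x i - withOrigin x j‖ + 2 * ρ') ^ 2 :=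
      pow_le_pow_left₀ (norm_nonneg _) (by linarith [h1.1]) 2
    simp only [hc]
    nlinarith [mul_le_mul_of_nonneg_left h2 hρ]

lemma le_sum_tuplesAt (hF : ∀ i, IsTile (side i.succ) (F i) (ρ i)) {x₀ : Space L}
    (hx₀ : x₀ ∈ side 0) {r : ℝ} (hρ : 0 ≤ ρ') (hρ' : ∀ i, ρ i ≤ ρ') (hr : 2 * ρ' < r)
    (i j : Fin (k + 1)) :
    (r - 2 * ρ') ^ (k * L + 2) * bodyMoment k L i j -
        4 * ρ' * r * ((r - 2 * ρ') ^ (k * L) * bodyVolume k L) ≤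
      (∏ i, volume.real (F i)) *
        ∑ t ∈ (finite_tuplesAt hF r x₀).toFinset, ‖t i - t j‖ ^ 2 := by
  have hb : ∀ i, ∀ y ∈ F i, ‖y‖ ≤ ρ' := fun i y hy => ((hF i).norm_le y hy).trans (hρ' i)
  have hcont : Continuous fun x : Fin k → Space L => ‖withOrigin x i - withOrigin x j‖ ^ 2 :=
    (continuous_withOrigin_sub i j).pow 2
  have hK := isCompact_tupleBody k L (r - 2 * ρ')
  have h := setIntegral_le_sum_tuplesAt hF hx₀ (r := r) hρ hρ'
    (g := fun t => ‖t i - t j‖ ^ 2)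
    (G := fun x => ‖withOrigin x i - withOrigin x j‖ ^ 2 - 4 * ρ' * r)
    (fun t => by positivity) (hcont.sub continuous_const) ?_
  · rw [integral_sub (hcont.continuousOn.integrableOn_compact hK)
      (integrableOn_const hK.measure_lt_top.ne), integral_tupleBody k L (by linarith),
      setIntegral_const, volume_tupleBody k L (by linarith), smul_eq_mul,
      mul_comm _ (4 * ρ' * r)] at h
    exact h
  · intro t ht x hx hxB
    have h1 := (abs_le.1 (abs_dist_sub_of_mem_tupleCell hρ hb ht.1 hx i j)).2
    have h2 := hxB i j
    set a := ‖withOrigin x i - withOrigin x j‖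
    have h4 : ρ' * a ≤ ρ' * r := mul_le_mul_of_nonneg_left (by linarith) hρ
    -- If a ≤ 2ρ', then a² ≤ 2ρ'a ≤ 4ρ'r and the left side is not positive; otherwise a − 2ρ' may be
    -- squared.
    rcases le_total a (2 * ρ') with h3 | h3
    · have ha : 0 ≤ a := norm_nonneg _
      nlinarith [sq_nonneg ‖t i - t j‖]
    · have : (a - 2 * ρ') ^ 2 ≤ ‖t i - t j‖ ^ 2 :=
        pow_le_pow_left₀ (by linarith) (by linarith) 2
      nlinarith [sq_nonneg ρ']

end Tuples

/-! ### Tiles of similar lattices -/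

lemma GeometricallySimilar.trans {L : ℕ} {M M' M'' : Submodule ℤ (Space L)}
    (h : GeometricallySimilar M M') (h' : GeometricallySimilar M' M'') :
    GeometricallySimilar M M'' := by
  obtain ⟨c, U, hc, hM⟩ := h
  obtain ⟨c', U', hc', hM'⟩ := h'
  refine ⟨c' * c, U.trans U', mul_pos hc' hc, ?_⟩
  rw [hM', hM, Set.image_image]
  simp [mul_smul]

open scoped Pointwise in
-- The tile is the half-open parallelepiped of the transported basis, for which translates do not
-- overlap even on boundaries. One bound `D` serves all similar lattices, since the map carrying `M`
-- to `M'` scales the tile radius by `c` and the volume by `c ^ L`.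
lemma exists_tile {L : ℕ} (M : Submodule ℤ (Space L)) [DiscreteTopology M] [IsZLattice ℝ M] :
    ∃ D : ℝ, ∀ M' : Submodule ℤ (Space L), GeometricallySimilar M M' →
      ∃ (_ : DiscreteTopology M') (_ : IsZLattice ℝ M') (c : ℝ), 0 < c ∧
        ZLattice.covolume M' = c ^ L * ZLattice.covolume M ∧
        ∃ F, IsTile M' F (c * D) ∧ volume.real F = ZLattice.covolume M' := by
  let b := (Module.Free.chooseBasis ℤ M).ofZLatticeBasis ℝ M
  obtain ⟨D, hD⟩ := (ZSpan.fundamentalDomain_isBounded b).exists_norm_le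
  refine ⟨D, ?_⟩
  rintro M' ⟨c, U, hc, hM'⟩
  let e : Space L ≃ₗ[ℝ] Space L :=
    U.toLinearEquiv.trans (LinearEquiv.smulOfNeZero ℝ (Space L) c hc.ne')
  have he : ∀ x, e x = c • U x := fun x => rfl
  obtain rfl : M' = Submodule.span ℤ (Set.range (b.map e)) := by
    rw [← ZSpan.map]
    apply SetLike.coe_injective
    rw [hM', (Module.Free.chooseBasis ℤ M).ofZLatticeBasis_span ℝ, Submodule.map_coe]
    rfl
  have hF : ZSpan.fundamentalDomain (b.map e) = c • (U '' ZSpan.fundamentalDomain b) := by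
    rw [← ZSpan.map_fundamentalDomain, ← Set.image_smul, Set.image_image]
    rfl
  have hvol : volume.real (ZSpan.fundamentalDomain (b.map e)) =
      ZLattice.covolume (Submodule.span ℤ (Set.range (b.map e))) :=
    (ZLattice.covolume_eq_measure_fundamentalDomain _ volume
      (ZSpan.isAddFundamentalDomain (b.map e) volume)).symm
  refine ⟨inferInstance, inferInstance, c, hc, ?_, _, ⟨?_, ?_, ?_, ?_, ?_⟩, hvol⟩
  · rw [← hvol, hF, Measure.real, Measure.addHaar_smul, finrank_euclideanSpace_fin,
      ENNReal.toReal_mul, ENNReal.toReal_ofReal (abs_nonneg _), abs_of_pos (pow_pos hc _),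
      U.image_eq_preimage_symm, U.symm.measurePreserving.measure_preimage
        (ZSpan.fundamentalDomain_measurableSet b).nullMeasurableSet,
      ZLattice.covolume_eq_measure_fundamentalDomain M volume
        (ZLattice.isAddFundamentalDomain (Module.Free.chooseBasis ℤ M) volume)]
    rfl
  · exact ZSpan.fundamentalDomain_measurableSet _
  · rw [hvol]
    exact ZLattice.covolume_pos _ volume
  · intro y hy
    rw [hF] at hy
    obtain ⟨_, ⟨x, hx, rfl⟩, rfl⟩ := hy
    change ‖c • U x‖ ≤ c * D
    rw [norm_smul, U.norm_map, Real.norm_of_nonneg hc.le]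
    exact mul_le_mul_of_nonneg_left (hD x hx) hc.le
  · intro y
    obtain ⟨a, ha, -⟩ := ZSpan.exist_unique_vadd_mem_fundamentalDomain (b.map e) y
    refine ⟨-a, neg_mem a.2, ?_⟩
    rw [sub_neg_eq_add, add_comm]
    exact ha
  · intro y a ha a' ha' h h'
    obtain ⟨x, -, hx⟩ := ZSpan.exist_unique_vadd_mem_fundamentalDomain (b.map e) y
    have h1 := hx ⟨-a, neg_mem ha⟩ (by
      change -a + y ∈ _
      rwa [neg_add_eq_sub])
    have h2 := hx ⟨-a', neg_mem ha'⟩ (by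
      change -a' + y ∈ _
      rwa [neg_add_eq_sub])
    have h3 := congrArg Subtype.val (h1.trans h2.symm)
    exact neg_injective h3

/-! ### Voronoi cells of clean sublattices -/

section Voronoi

variable {L : ℕ} {Λ P : Submodule ℤ (Space L)}

lemma exists_sub_mem_voronoiCell (P : Submodule ℤ (Space L)) [DiscreteTopology P] (x : Space L) :
    ∃ p ∈ P, x - p ∈ voronoiCell (P : Set (Space L)) 0 := by
  have hclosed : IsClosed (P : Set (Space L)) := by
    have : DiscreteTopology P.toAddSubgroup := ‹DiscreteTopology P›
    exact AddSubgroup.isClosed_of_discrete (H := P.toAddSubgroup)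
  obtain ⟨p, hp, hdist⟩ := hclosed.exists_infDist_eq_dist ⟨0, P.zero_mem⟩ x
  refine ⟨p, hp, fun s hs => ?_⟩
  have h := Metric.infDist_le_dist_of_mem (x := x) (P.add_mem hp hs)
  rw [hdist, dist_eq_norm, dist_eq_norm] at h
  simpa [sub_sub] using h

/-- Two distinct congruent points of one cell make `x` equidistant from 0 and −p, so `x` is a
boundary point, contrary to cleanness. -/
lemma eq_zero_of_mem_voronoiCell (hclean : IsClean Λ P) {x p : Space L} (hx : x ∈ Λ) (hp : p ∈ P)
    (hxV : x ∈ voronoiCell (P : Set (Space L)) 0)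
    (hpV : x + p ∈ voronoiCell (P : Set (Space L)) 0) : p = 0 := by
  by_contra hp0
  have h1 : ‖x‖ ≤ ‖x + p‖ := by simpa using hxV (-p) (P.neg_mem hp)
  have h2 : ‖x + p‖ ≤ ‖x‖ := by simpa using hpV p hp
  have heq := le_antisymm h1 h2
  refine hclean x hx 0 P.zero_mem ⟨subset_closure hxV, fun hint => ?_⟩
  -- Moving from `x` in the direction −p brings −p strictly nearer than 0, so the cell is left at
  -- once.
  have hcont : Tendsto (fun t : ℝ => x - t • p) (𝓝[>] 0) (𝓝 x) := by
    have : Continuous fun t : ℝ => x - t • p := by fun_prop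
    simpa using (this.tendsto 0).mono_left nhdsWithin_le_nhds
  have hev := hcont.eventually (mem_interior_iff_mem_nhds.1 hint)
  obtain ⟨t, ht, ht0⟩ := (hev.and self_mem_nhdsWithin).exists
  have ht0 : (0:ℝ) < t := ht0
  have h3 : ‖x - t • p‖ ≤ ‖x - t • p + p‖ := by simpa using ht (-p) (P.neg_mem hp)
  have h4 : ‖x - t • p‖ ^ 2 ≤ ‖x - t • p + p‖ ^ 2 := pow_le_pow_left₀ (norm_nonneg _) h3 2
  have h5 : ‖x‖ ^ 2 = ‖x + p‖ ^ 2 := by rw [heq]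
  rw [norm_add_sq_real] at h5
  rw [norm_add_sq_real, inner_sub_left, inner_smul_left, real_inner_self_eq_norm_sq] at h4
  have h6 : 0 < ‖p‖ ^ 2 := by positivity
  simp only [conj_trivial] at h4
  nlinarith

/-- The points of `Λ` in the Voronoi cell of `P` around the origin. -/
def voronoiPoints (Λ P : Submodule ℤ (Space L)) : Set (Space L) :=
  {x | x ∈ Λ ∧ x ∈ voronoiCell (P : Set (Space L)) 0}

/-- Every coset has a representative in the cell by subtracting a nearest point of `P`; cleanness
makes it unique. -/
lemma bijective_voronoiPoints (hclean : IsClean Λ P) (hle : P ≤ Λ) [DiscreteTopology P] :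
    Function.Bijective fun x : voronoiPoints Λ P =>
      (QuotientAddGroup.mk ⟨x.1, x.2.1⟩ :
        Λ.toAddSubgroup ⧸ P.toAddSubgroup.addSubgroupOf Λ.toAddSubgroup) := by
  constructor
  · rintro ⟨x, hx, hxV⟩ ⟨y, hy, hyV⟩ h
    rw [QuotientAddGroup.eq] at h
    have h : -x + y ∈ P := h
    have h0 := eq_zero_of_mem_voronoiCell hclean hx h hxV (by simpa using hyV)
    ext1
    exact (neg_add_eq_zero.1 h0)
  · intro q
    obtain ⟨⟨y, hy⟩, rfl⟩ := QuotientAddGroup.mk_surjective q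
    obtain ⟨p, hp, hpV⟩ := exists_sub_mem_voronoiCell P y
    refine ⟨⟨y - p, Λ.sub_mem hy (hle hp), hpV⟩, ?_⟩
    rw [QuotientAddGroup.eq]
    change -(y - p) + y ∈ P
    simpa using hp

lemma ncard_voronoiPoints (hclean : IsClean Λ P) (hle : P ≤ Λ) [DiscreteTopology P] :
    (voronoiPoints Λ P).ncard = latticeIndex Λ P := by
  rw [← Nat.card_coe_set_eq, Nat.card_eq_of_bijective _ (bijective_voronoiPoints hclean hle)]
  rfl

lemma finite_voronoiPoints (hclean : IsClean Λ P) (hle : P ≤ Λ) [DiscreteTopology P]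
    (h0 : latticeIndex Λ P ≠ 0) : (voronoiPoints Λ P).Finite := by
  apply Set.finite_of_ncard_ne_zero
  rwa [ncard_voronoiPoints hclean hle]

lemma covolume_eq_latticeIndex_mul [DiscreteTopology Λ] [IsZLattice ℝ Λ] [DiscreteTopology P]
    [IsZLattice ℝ P] (hle : P ≤ Λ) :
    ZLattice.covolume P = latticeIndex Λ P * ZLattice.covolume Λ := by
  rw [latticeIndex, ← ZLattice.covolume_div_covolume_eq_relIndex' P Λ hle,
    div_mul_cancel₀ _ (ZLattice.covolume_ne_zero Λ volume)]

/-- `relIndex` is 0 for infinite index; positivity of the covolume of `P` excludes this. -/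
lemma latticeIndex_ne_zero [DiscreteTopology Λ] [IsZLattice ℝ Λ] [DiscreteTopology P]
    [IsZLattice ℝ P] (hle : P ≤ Λ) : latticeIndex Λ P ≠ 0 := by
  intro h
  have := covolume_eq_latticeIndex_mul hle
  rw [h, Nat.cast_zero, zero_mul] at this
  exact ZLattice.covolume_ne_zero P volume this

end Voronoi

/-! ### Bounds for a single design -/

namespace AsymmetricDesign

variable {k L : ℕ} (d : AsymmetricDesign (k + 1) L)

lemma zero_mem_voronoiCell : (0 : Space L) ∈ voronoiCell (d.product : Set (Space L)) 0 :=
  fun s _ => by simp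

lemma radius_spec {x : Space L} (hx : x ∈ d.side 0)
    (hxV : x ∈ voronoiCell (d.product : Set (Space L)) 0) :
    d.index 0 ≤ (tuplesAt d.side d.radius x).ncard :=
  d.radius_isLeast.1 x hx hxV

/-- The sole use of the minimality of the radius. The location of `x` in the Voronoi cell is dropped
because the lower count holds at every point of Λ₀. -/
lemma exists_ncard_lt {r : ℝ} (hr : r < d.radius) :
    ∃ x ∈ d.side 0, (tuplesAt d.side r x).ncard < d.index 0 := by
  by_contra! h
  exact (d.radius_isLeast.2 fun x hx _ => h x hx).not_gt hr

lemma radius_nonneg (h0 : d.index 0 ≠ 0) : 0 ≤ d.radius := by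
  have h := d.radius_spec (d.side 0).zero_mem d.zero_mem_voronoiCell
  obtain ⟨t, ht⟩ := Set.nonempty_of_ncard_ne_zero (by omega :
    (tuplesAt d.side d.radius (0 : Space L)).ncard ≠ 0)
  simpa using ht.2.2 0 0

/-- The squared differences of two labels, summed over a period. -/
def labelSum (i j : Fin (k + 1)) : ℝ :=
  ∑ᶠ x : {x : d.central // (x : Space L) ∈ voronoiCell (d.product : Set (Space L)) 0},
    ‖d.label x.1 i - d.label x.1 j‖ ^ 2

lemma product_le_central : d.product ≤ d.central := (d.product_le 0).trans (d.side_le 0)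

/-- Each label is shifted by the element of Λ_π that brings its first coordinate into V_π(0). The
shift leaves the differences unchanged, and it keeps labels distinct because the central points
involved are pairwise incongruent modulo Λ_π. -/
lemma exists_usedTuples [DiscreteTopology d.product] (hπ : d.productIndex ≠ 0) :
    ∃ U : Finset (Fin (k + 1) → Space L),
      (∀ t ∈ U, t 0 ∈ voronoiPoints (d.side 0) d.product ∧
        t ∈ tuplesAt d.side d.radius (t 0)) ∧
      U.card = d.productIndex ∧
      ∀ i j, ∑ t ∈ U, ‖t i - t j‖ ^ 2 = d.labelSum i j := by
  classical
  let X := {x : d.central // (x : Space L) ∈ voronoiCell (d.product : Set (Space L)) 0}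
  let e : X ≃ voronoiPoints d.central d.product :=
    { toFun := fun x => ⟨x.1.1, x.1.2, x.2⟩
      invFun := fun x => ⟨⟨x.1, x.2.1⟩, x.2.2⟩
      left_inv := fun _ => rfl
      right_inv := fun _ => rfl }
  have hfin := finite_voronoiPoints d.product_clean d.product_le_central hπ
  have : Finite (voronoiPoints d.central d.product) := hfin
  have : Finite X := Finite.of_equiv _ e.symm
  have : Fintype X := Fintype.ofFinite X
  choose p hp hpV using fun x : X => exists_sub_mem_voronoiCell d.product (d.label x.1 0)
  have hpc : ∀ x, p x ∈ d.central := fun x => d.product_le_central (hp x)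
  let y : X → d.central := fun x => x.1 + ⟨-p x, neg_mem (hpc x)⟩
  have hy : ∀ x i, d.label (y x) i = d.label x.1 i - p x := fun x i => by
    rw [d.label_shift x.1 ⟨-p x, neg_mem (hpc x)⟩ (neg_mem (hp x)) i, sub_eq_add_neg]
  have hinj : Function.Injective fun x => d.label (y x) := by
    intro a b hab
    have h1 : (a.1 : Space L) + -p a = b.1 + -p b :=
      congrArg Subtype.val (d.label_injective hab)
    have h2 : (a.1 : Space L) + (p b - p a) = b.1 := by
      have h : (a.1 : Space L) + (p b - p a) = a.1 + -p a + p b := by abel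
      rw [h, h1, neg_add_cancel_right]
    have h3 := eq_zero_of_mem_voronoiCell d.product_clean a.1.2
      (sub_mem (hp b) (hp a)) a.2 (by rw [h2]; exact b.2)
    rw [h3, add_zero] at h2
    exact Subtype.ext (Subtype.ext h2)
  refine ⟨Finset.univ.image fun x => d.label (y x), ?_, ?_, ?_⟩
  · intro t ht
    obtain ⟨x, -, rfl⟩ := Finset.mem_image.1 ht
    refine ⟨⟨d.label_mem _ _, ?_⟩, rfl, fun i => d.label_mem _ _, fun i j => d.label_dist _ _ _⟩
    rw [hy]
    exact hpV x
  · rw [Finset.card_image_of_injective _ hinj, Finset.card_univ, ← Nat.card_eq_fintype_card,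
      Nat.card_congr e, Nat.card_coe_set_eq, ncard_voronoiPoints d.product_clean
      d.product_le_central]
    rfl
  · intro i j
    rw [Finset.sum_image fun a _ b _ h => hinj h, labelSum, finsum_eq_sum_of_fintype]
    refine Finset.sum_congr rfl fun x _ => ?_
    rw [hy, hy, sub_sub_sub_cancel_right]

variable {F : Fin k → Set (Space L)} {ρ : Fin k → ℝ} {ρ' : ℝ}

lemma index_mul_le_prod (hF : ∀ i, IsTile (d.side i.succ) (F i) (ρ i)) (h0 : d.index 0 ≠ 0) :
    (∏ i, volume.real (F i)) * (d.index 0 : ℝ) ≤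
      ∏ i, (d.radius + ρ i) ^ L * unitBallVolume L := by
  refine le_trans ?_ (card_tuplesAt_le_prod hF 0 (d.radius_nonneg h0))
  refine mul_le_mul_of_nonneg_left ?_ (Finset.prod_nonneg fun i _ => measureReal_nonneg)
  exact_mod_cast d.radius_spec (d.side 0).zero_mem d.zero_mem_voronoiCell

lemma index_mul_le (hF : ∀ i, IsTile (d.side i.succ) (F i) (ρ i)) (hr : 0 < d.radius)
    (hρ : 0 ≤ ρ') (hρ' : ∀ i, ρ i ≤ ρ') :
    (∏ i, volume.real (F i)) * (d.index 0 : ℝ) ≤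
      (d.radius + 2 * ρ') ^ (k * L) * bodyVolume k L := by
  refine le_trans ?_ (card_tuplesAt_le hF 0 hr hρ hρ')
  refine mul_le_mul_of_nonneg_left ?_ (Finset.prod_nonneg fun i _ => measureReal_nonneg)
  exact_mod_cast d.radius_spec (d.side 0).zero_mem d.zero_mem_voronoiCell

/-- For each r below the radius some λ₀ has fewer than N₀ tuples, while the lower count holds there
too. Nothing of the kind is known at the radius itself, hence the limit from the left. -/
lemma le_index_mul (hF : ∀ i, IsTile (d.side i.succ) (F i) (ρ i)) (hρ : 0 ≤ ρ')
    (hρ' : ∀ i, ρ i ≤ ρ') (hr : 2 * ρ' < d.radius) :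
    (d.radius - 2 * ρ') ^ (k * L) * bodyVolume k L ≤
      (∏ i, volume.real (F i)) * (d.index 0 : ℝ) := by
  have hlim : Tendsto (fun r : ℝ => (r - 2 * ρ') ^ (k * L) * bodyVolume k L) (𝓝[<] d.radius)
      (𝓝 ((d.radius - 2 * ρ') ^ (k * L) * bodyVolume k L)) := by
    have : Continuous fun r : ℝ => (r - 2 * ρ') ^ (k * L) * bodyVolume k L := by fun_prop
    exact (this.tendsto _).mono_left nhdsWithin_le_nhds
  refine le_of_tendsto hlim ?_
  filter_upwards [Ioo_mem_nhdsLT hr] with r hr'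
  obtain ⟨x, hx, hlt⟩ := d.exists_ncard_lt hr'.2
  refine (le_card_tuplesAt hF hx hρ hρ' hr'.1).trans ?_
  refine mul_le_mul_of_nonneg_left ?_ (Finset.prod_nonneg fun i _ => measureReal_nonneg)
  exact_mod_cast hlt.le

/-- The used tuples are compared with the set `A` of all tuples whose first coordinate lies in Λ₀ ∩
V_π(0), a set of N_π/N₀ points. The subtracted term in the lower bound is `radius ^ 2` times a bound
for the number of unused tuples. Multiplying by N₀ and the cell volume avoids division. -/
lemma labelSum_bounds [DiscreteTopology d.product] (hπ : d.productIndex ≠ 0)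
    (hF : ∀ i, IsTile (d.side i.succ) (F i) (ρ i)) (hρ : 0 ≤ ρ')
    (hρ' : ∀ i, ρ i ≤ ρ') (hr : 2 * ρ' < d.radius) (i j : Fin (k + 1)) :
    (∏ i, volume.real (F i)) * (d.labelSum i j * d.index 0) ≤
      d.productIndex * ((d.radius + 2 * ρ') ^ (k * L + 2) * bodyMoment k L i j +
        (4 * ρ' * (d.radius + 2 * ρ') + 4 * ρ' ^ 2) *
          ((d.radius + 2 * ρ') ^ (k * L) * bodyVolume k L)) ∧
    d.productIndex * ((d.radius - 2 * ρ') ^ (k * L + 2) * bodyMoment k L i j -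
        4 * ρ' * d.radius * ((d.radius - 2 * ρ') ^ (k * L) * bodyVolume k L)) -
      d.radius ^ 2 * (d.productIndex * ((d.radius + 2 * ρ') ^ (k * L) * bodyVolume k L) -
        (∏ i, volume.real (F i)) * (d.productIndex * d.index 0)) ≤
      (∏ i, volume.real (F i)) * (d.labelSum i j * d.index 0) := by
  classical
  obtain ⟨U, hU, hcard, hsum⟩ := d.exists_usedTuples hπ
  have hclean : IsClean (d.side 0) d.product := fun x hx => d.product_clean x (d.side_le 0 hx)
  have hmul : latticeIndex (d.side 0) d.product * d.index 0 = d.productIndex :=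
    AddSubgroup.relIndex_mul_relIndex _ _ _ (d.product_le 0) (d.side_le 0)
  have hne : latticeIndex (d.side 0) d.product ≠ 0 := by
    intro h
    rw [h, zero_mul] at hmul
    exact hπ hmul.symm
  have hZ := finite_voronoiPoints hclean (d.product_le 0) hne
  have hZcard : (hZ.toFinset.card : ℝ) * d.index 0 = d.productIndex := by
    rw [← Set.ncard_eq_toFinset_card _ hZ, ncard_voronoiPoints hclean (d.product_le 0)]
    exact_mod_cast hmul
  have hr0 : 0 < d.radius := by linarith
  set V := ∏ i, volume.real (F i)
  have hV : 0 ≤ V := Finset.prod_nonneg fun i _ => measureReal_nonneg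
  let T : Space L → Finset (Fin (k + 1) → Space L) := fun x =>
    (finite_tuplesAt hF d.radius x).toFinset
  have hT : ∀ x t, t ∈ T x ↔ t ∈ tuplesAt d.side d.radius x := fun x t => by simp [T]
  have hTcard : ∀ x, ((T x).card : ℝ) = ((tuplesAt d.side d.radius x).ncard : ℝ) := fun x => by
    rw [Set.ncard_eq_toFinset_card _ (finite_tuplesAt hF d.radius x)]
  let A := hZ.toFinset.biUnion T
  have hdisj : (hZ.toFinset : Set (Space L)).PairwiseDisjoint T := by
    intro a _ b _ hab
    refine Finset.disjoint_left.2 fun t hta htb => hab ?_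
    rw [← ((hT _ _).1 hta).1, ((hT _ _).1 htb).1]
  have hUA : U ⊆ A := fun t ht =>
    Finset.mem_biUnion.2 ⟨t 0, by simpa using (hU t ht).1, (hT _ _).2 (hU t ht).2⟩
  have hAle : ∀ t ∈ A, ‖t i - t j‖ ^ 2 ≤ d.radius ^ 2 := fun t ht => by
    obtain ⟨x, -, hx⟩ := Finset.mem_biUnion.1 ht
    exact pow_le_pow_left₀ (norm_nonneg _) (((hT _ _).1 hx).2.2 i j) 2
  have hAsum : ∑ t ∈ A, ‖t i - t j‖ ^ 2 = ∑ x ∈ hZ.toFinset, ∑ t ∈ T x, ‖t i - t j‖ ^ 2 :=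
    Finset.sum_biUnion hdisj
  have hAcard : (A.card : ℝ) = ∑ x ∈ hZ.toFinset, ((T x).card : ℝ) := by
    rw [Finset.card_biUnion hdisj, Nat.cast_sum]
  have hupper : V * ∑ t ∈ A, ‖t i - t j‖ ^ 2 ≤ hZ.toFinset.card *
      ((d.radius + 2 * ρ') ^ (k * L + 2) * bodyMoment k L i j +
        (4 * ρ' * (d.radius + 2 * ρ') + 4 * ρ' ^ 2) *
          ((d.radius + 2 * ρ') ^ (k * L) * bodyVolume k L)) := by
    rw [hAsum, Finset.mul_sum, ← nsmul_eq_mul]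
    exact Finset.sum_le_card_nsmul _ _ _ fun x _ => sum_tuplesAt_le hF x hr0 hρ hρ' i j
  have hlower : hZ.toFinset.card *
      ((d.radius - 2 * ρ') ^ (k * L + 2) * bodyMoment k L i j -
        4 * ρ' * d.radius * ((d.radius - 2 * ρ') ^ (k * L) * bodyVolume k L)) ≤
      V * ∑ t ∈ A, ‖t i - t j‖ ^ 2 := by
    rw [hAsum, Finset.mul_sum, ← nsmul_eq_mul]
    refine Finset.card_nsmul_le_sum _ _ _ fun x hx => le_sum_tuplesAt hF ?_ hρ hρ' hr i j
    exact (hZ.mem_toFinset.1 hx).1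
  have hcardA : V * (A.card : ℝ) ≤ hZ.toFinset.card *
      ((d.radius + 2 * ρ') ^ (k * L) * bodyVolume k L) := by
    rw [hAcard, Finset.mul_sum, ← nsmul_eq_mul]
    refine Finset.sum_le_card_nsmul _ _ _ fun x _ => ?_
    rw [hTcard]
    exact card_tuplesAt_le hF x hr0 hρ hρ'
  have hUle : d.labelSum i j ≤ ∑ t ∈ A, ‖t i - t j‖ ^ 2 := by
    rw [← hsum]
    exact Finset.sum_le_sum_of_subset_of_nonneg hUA fun _ _ _ => by positivity
  -- Each of the |A| − N_π tuples outside `U` contributes at most the squared radius.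
  have hleU : ∑ t ∈ A, ‖t i - t j‖ ^ 2 - d.radius ^ 2 * (A.card - d.productIndex) ≤
      d.labelSum i j := by
    rw [← hsum, ← Finset.sum_sdiff hUA]
    have h1 : ∑ t ∈ A \ U, ‖t i - t j‖ ^ 2 ≤ (A \ U).card • d.radius ^ 2 :=
      Finset.sum_le_card_nsmul _ _ _ fun t ht => hAle t (Finset.sdiff_subset ht)
    rw [nsmul_eq_mul, Finset.cast_card_sdiff hUA, hcard] at h1
    linarith
  have hN0 : (0:ℝ) ≤ d.index 0 := Nat.cast_nonneg _
  refine ⟨?_, ?_⟩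
  · rw [← hZcard]
    have := mul_le_mul_of_nonneg_right (mul_le_mul_of_nonneg_left hUle hV) hN0
    have h2 := mul_le_mul_of_nonneg_right hupper hN0
    linarith
  · have h1 := mul_le_mul_of_nonneg_right (mul_le_mul_of_nonneg_left hleU hV) hN0
    have h2 := mul_le_mul_of_nonneg_right hlower hN0
    have h3 := mul_le_mul_of_nonneg_right
      (mul_le_mul_of_nonneg_left hcardA (sq_nonneg d.radius)) hN0
    rw [← hZcard] at h1 ⊢
    linarith

end AsymmetricDesign

/-! ### Asymptotics of a sequence of designs -/

lemma unitBallVolume_pos (L : ℕ) : 0 < unitBallVolume L :=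
  ENNReal.toReal_pos (Metric.measure_closedBall_pos volume (0 : Space L) one_pos).ne'
    measure_closedBall_lt_top.ne

lemma expansionFactor_pos (k L : ℕ) : 0 < expansionFactor (k + 1) L := by
  refine Real.rpow_pos_of_pos (div_pos (pow_pos (unitBallVolume_pos L) _) ?_) _
  rw [tupleVolume_eq]
  exact bodyVolume_pos k L

lemma expansionFactor_pow {k L : ℕ} (hk : 0 < k) (hL : 0 < L) :
    (expansionFactor (k + 1) L ^ L) ^ k = unitBallVolume L ^ k / bodyVolume k L := by
  have h : (1 / ((L : ℝ) * (((k + 1 : ℕ) : ℝ) - 1))) = ((L * k : ℕ) : ℝ)⁻¹ := by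
    push_cast
    rw [add_sub_cancel_right, one_div]
  rw [← pow_mul, expansionFactor, h, tupleVolume_eq, Nat.add_sub_cancel,
    Real.rpow_inv_natCast_pow (div_nonneg (pow_nonneg (unitBallVolume_pos L).le _)
      (bodyVolume_pos k L).le) (by positivity)]

namespace AsymmetricDesign

variable {k L : ℕ} (d : AsymmetricDesign (k + 1) L)

/-- The continuum approximation of the number of tuples per point of the first sublattice, divided
by the required number. -/
def fillRatio : ℝ :=
  d.radius ^ (k * L) * bodyVolume k L / ((∏ i : Fin k, d.sideCellVolume i.succ) * d.index 0)

lemma predictedBallVolume_pos (hν : 0 < d.cellVolume) (hN : ∀ i, d.index i ≠ 0) :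
    0 < d.predictedBallVolume := by
  have h1 := expansionFactor_pos k L
  have h2 : 0 < ∏ m, (d.index m : ℝ) ^ (1 / (((k + 1 : ℕ) : ℝ) - 1)) :=
    Finset.prod_pos fun m _ => Real.rpow_pos_of_pos
      (Nat.cast_pos.2 (Nat.pos_of_ne_zero (hN m))) _
  exact mul_pos (mul_pos (pow_pos h1 _) hν) h2

/-- The predicted volume is the one at which the continuum count of tuples equals N₀ exactly. -/
lemma predictedBallVolume_pow (hk : 0 < k) (hL : 0 < L) :
    d.predictedBallVolume ^ k * bodyVolume k L =
      unitBallVolume L ^ k * ((∏ i : Fin k, d.sideCellVolume i.succ) * d.index 0) := by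
  have h1 : ∀ m, ((d.index m : ℝ) ^ (1 / (((k + 1 : ℕ) : ℝ) - 1))) ^ k = d.index m := fun m => by
    rw [Nat.cast_add, Nat.cast_one, add_sub_cancel_right, one_div,
      Real.rpow_inv_natCast_pow (Nat.cast_nonneg _) hk.ne']
  rw [predictedBallVolume, mul_pow, mul_pow, expansionFactor_pow hk hL, ← Finset.prod_pow,
    Finset.prod_congr rfl fun m _ => h1 m, Fin.prod_univ_succ]
  simp only [sideCellVolume, Finset.prod_mul_distrib, Finset.prod_const, Finset.card_univ,
    Fintype.card_fin]
  field_simp [(bodyVolume_pos k L).ne']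

lemma ballVolume_div_pow (hk : 0 < k) (hL : 0 < L) (hν : 0 < d.cellVolume)
    (hN : ∀ i, d.index i ≠ 0) :
    (d.ballVolume / d.predictedBallVolume) ^ k = d.fillRatio := by
  have hp := d.predictedBallVolume_pos hν hN
  have h := d.predictedBallVolume_pow hk hL
  have hI := bodyVolume_pos k L
  have hω := unitBallVolume_pos L
  have hV : (∏ i : Fin k, d.sideCellVolume i.succ) * d.index 0 ≠ 0 := by
    intro h0
    rw [h0, mul_zero] at h
    exact (mul_pos (pow_pos hp k) hI).ne' h
  rw [div_pow, fillRatio, div_eq_div_iff (pow_pos hp k).ne' hV, ballVolume, mul_pow, ← pow_mul,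
    mul_comm L k]
  linear_combination -(d.radius ^ (k * L)) * h

lemma predictedDistortion_eq (hL : 0 < L) (hν : 0 < d.cellVolume) :
    d.predictedDistortion =
      d.predictedBallVolume ^ (2 / (L : ℝ)) * (sphereSecondMoment L * d.productIndex) := by
  have hψ := expansionFactor_pos k L
  have hL' : (L : ℝ) ≠ 0 := by positivity
  have h1 : ∀ m, ((d.index m : ℝ) ^ (1 / (((k + 1 : ℕ) : ℝ) - 1))) ^ (2 / (L : ℝ)) =
      (d.index m : ℝ) ^ (2 / ((L : ℝ) * (((k + 1 : ℕ) : ℝ) - 1))) := fun m => by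
    rw [← Real.rpow_mul (Nat.cast_nonneg _), div_mul_div_comm, one_mul, mul_comm (L : ℝ)]
  have h2 : (expansionFactor (k + 1) L ^ L) ^ (2 / (L : ℝ)) = expansionFactor (k + 1) L ^ 2 := by
    rw [← Real.rpow_natCast, ← Real.rpow_mul hψ.le, mul_div_cancel₀ _ hL']
    norm_cast
  have h3 : ∀ m ∈ Finset.univ, 0 ≤ (d.index m : ℝ) ^ (1 / (((k + 1 : ℕ) : ℝ) - 1)) := fun m _ =>
    Real.rpow_nonneg (Nat.cast_nonneg _) _
  rw [predictedDistortion, predictedBallVolume,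
    Real.mul_rpow (by positivity) (Finset.prod_nonneg h3),
    Real.mul_rpow (by positivity) hν.le, h2, ← Real.finsetProd_rpow _ _ h3,
    Finset.prod_congr rfl fun m _ => h1 m]
  ring

/-- Separates the mean squared distance in units of r², the error in the ball volume, and the
reciprocal of the mean of ‖x‖² over the unit ball. -/
lemma pairDistortion_div (hL : 0 < L) (hν : 0 < d.cellVolume) (hN : ∀ i, d.index i ≠ 0)
    (hr : 0 < d.radius) (i j : Fin (k + 1)) :
    d.pairDistortion i j / d.predictedDistortion =
      d.labelSum i j / (d.productIndex * d.radius ^ 2) *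
        ((d.ballVolume / d.predictedBallVolume) ^ (2 / (L : ℝ)) *
        (unitBallVolume L / ∫ x in Metric.closedBall (0 : Space L) 1, ‖x‖ ^ 2)) := by
  have hp := d.predictedBallVolume_pos hν hN
  have hω := unitBallVolume_pos L
  have hL' : (L : ℝ) ≠ 0 := by positivity
  have h2 : (d.radius ^ L) ^ (2 / (L : ℝ)) = d.radius ^ 2 := by
    rw [← Real.rpow_natCast, ← Real.rpow_mul hr.le, mul_div_cancel₀ _ hL']
    norm_cast
  rw [d.predictedDistortion_eq hL hν, ballVolume, Real.div_rpow (by positivity) hp.le,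
    Real.mul_rpow hω.le (by positivity), h2, pairDistortion, sphereSecondMoment,
    Real.rpow_add hω, Real.rpow_one]
  change 1 / (L : ℝ) * d.labelSum i j / _ = _
  have h3 : 0 < d.predictedBallVolume ^ (2 / (L : ℝ)) := Real.rpow_pos_of_pos hp _
  have h4 : 0 < unitBallVolume L ^ (2 / (L : ℝ)) := Real.rpow_pos_of_pos hω _
  field_simp

variable {F : Fin k → Set (Space L)} {ρ : Fin k → ℝ} {ρ' ε : ℝ}

lemma fillRatio_bounds (hF : ∀ i, IsTile (d.side i.succ) (F i) (ρ i))
    (hv : ∀ i, volume.real (F i) = d.sideCellVolume i.succ) (hN : d.index 0 ≠ 0)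
    (hr : 0 < d.radius) (hε : 0 ≤ ε) (hρ : ∀ i, ρ i ≤ ε * d.radius) (hε' : 2 * ε < 1) :
    ((1 + 2 * ε) ^ (k * L))⁻¹ ≤ d.fillRatio ∧ d.fillRatio ≤ ((1 - 2 * ε) ^ (k * L))⁻¹ := by
  have hW : 0 < (∏ i : Fin k, d.sideCellVolume i.succ) * (d.index 0 : ℝ) := by
    refine mul_pos (Finset.prod_pos fun i _ => ?_) (Nat.cast_pos.2 (Nat.pos_of_ne_zero hN))
    rw [← hv]
    exact (hF i).volume_pos
  have h1 := d.index_mul_le hF hr (ρ' := ε * d.radius) (by positivity) hρ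
  have h2 := d.le_index_mul hF (ρ' := ε * d.radius) (by positivity) hρ (by nlinarith)
  rw [Finset.prod_congr rfl fun i _ => hv i] at h1 h2
  rw [show d.radius + 2 * (ε * d.radius) = (1 + 2 * ε) * d.radius by ring, mul_pow] at h1
  rw [show d.radius - 2 * (ε * d.radius) = (1 - 2 * ε) * d.radius by ring, mul_pow] at h2
  have hp : 0 < (1 - 2 * ε) ^ (k * L) := pow_pos (by linarith) _
  constructor
  · rw [inv_le_iff_one_le_mul₀' (by positivity), fillRatio, ← mul_div_assoc, one_le_div hW]
    linarith
  · rw [fillRatio, inv_eq_one_div, div_le_div_iff₀ hW hp]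
    linarith

/-- The term `d.fillRatio * (1 + 2 * ε) ^ (k * L) - 1` bounds the unused tuples relative to N_π; it
vanishes in the limit because the fill ratio tends to 1. -/
lemma labelSum_div_bounds [DiscreteTopology d.product] (hπ : d.productIndex ≠ 0)
    (hF : ∀ i, IsTile (d.side i.succ) (F i) (ρ i))
    (hv : ∀ i, volume.real (F i) = d.sideCellVolume i.succ) (hN : d.index 0 ≠ 0)
    (hr : 0 < d.radius) (hε : 0 ≤ ε) (hρ : ∀ i, ρ i ≤ ε * d.radius) (hε' : 2 * ε < 1)
    (i j : Fin (k + 1)) :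
    d.labelSum i j / (d.productIndex * d.radius ^ 2) ≤
      d.fillRatio * ((1 + 2 * ε) ^ (k * L + 2) * (bodyMoment k L i j / bodyVolume k L) +
        (4 * ε * (1 + 2 * ε) + 4 * ε ^ 2) * (1 + 2 * ε) ^ (k * L)) ∧
    d.fillRatio * ((1 - 2 * ε) ^ (k * L + 2) * (bodyMoment k L i j / bodyVolume k L) -
        4 * ε * (1 - 2 * ε) ^ (k * L)) - (d.fillRatio * (1 + 2 * ε) ^ (k * L) - 1) ≤
      d.labelSum i j / (d.productIndex * d.radius ^ 2) := by
  have hW : 0 < (∏ i : Fin k, d.sideCellVolume i.succ) * (d.index 0 : ℝ) := by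
    refine mul_pos (Finset.prod_pos fun i _ => ?_) (Nat.cast_pos.2 (Nat.pos_of_ne_zero hN))
    rw [← hv]
    exact (hF i).volume_pos
  obtain ⟨h1, h2⟩ := d.labelSum_bounds hπ hF (ρ' := ε * d.radius) (by positivity) hρ
    (by nlinarith) i j
  rw [Finset.prod_congr rfl fun i _ => hv i] at h1 h2
  have hI := bodyVolume_pos k L
  have hP : (0:ℝ) < d.productIndex := Nat.cast_pos.2 (Nat.pos_of_ne_zero hπ)
  rw [show d.radius + 2 * (ε * d.radius) = (1 + 2 * ε) * d.radius by ring] at h1 h2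
  rw [show d.radius - 2 * (ε * d.radius) = (1 - 2 * ε) * d.radius by ring] at h2
  simp only [mul_pow, pow_add] at h1 h2 ⊢
  have hQ : d.fillRatio * ((∏ i : Fin k, d.sideCellVolume i.succ) * (d.index 0 : ℝ)) =
      d.radius ^ (k * L) * bodyVolume k L := div_mul_cancel₀ _ hW.ne'
  set Q := d.fillRatio
  set V := ∏ i : Fin k, d.sideCellVolume i.succ
  set N : ℝ := ((d.index 0 : ℕ) : ℝ)
  set P : ℝ := ((d.productIndex : ℕ) : ℝ)
  set r := d.radius
  set I := bodyVolume k L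
  set J := bodyMoment k L i j
  set S := d.labelSum i j
  have hJ : J = J / I * I := (div_mul_cancel₀ _ hI.ne').symm
  set E := J / I
  rw [hJ] at h1 h2
  have hPr : 0 < P * r ^ 2 := by positivity
  constructor
  · rw [div_le_iff₀ hPr, ← mul_le_mul_iff_of_pos_left hW]
    refine le_trans (le_of_eq (by ring)) (h1.trans (le_of_eq ?_))
    linear_combination (-(P * r ^ 2 * ((1 + 2 * ε) ^ (k * L) * (1 + 2 * ε) ^ 2 * E +
      (4 * ε * (1 + 2 * ε) + 4 * ε ^ 2) * (1 + 2 * ε) ^ (k * L)))) * hQ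
  · rw [le_div_iff₀ hPr, ← mul_le_mul_iff_of_pos_left hW]
    refine le_trans (le_of_eq ?_) (h2.trans (le_of_eq (by ring)))
    linear_combination (P * r ^ 2 * ((1 - 2 * ε) ^ (k * L) * (1 - 2 * ε) ^ 2 * E -
      4 * ε * (1 - 2 * ε) ^ (k * L) - (1 + 2 * ε) ^ (k * L))) * hQ

end AsymmetricDesign

/-! ### Limits of the quotients when the tiles are small compared with the radius. -/

section Limits

variable {k L : ℕ} {d : ℕ → AsymmetricDesign (k + 1) L} {F : ℕ → Fin k → Set (Space L)}
  {ρ : ℕ → Fin k → ℝ}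

/-- The sublattices of the designs have tiles that are small compared with the radius. -/
structure SmallTiles (d : ℕ → AsymmetricDesign (k + 1) L) (F : ℕ → Fin k → Set (Space L))
    (ρ : ℕ → Fin k → ℝ) : Prop where
  isTile : ∀ n i, IsTile ((d n).side i.succ) (F n i) (ρ n i)
  volume_eq : ∀ n i, volume.real (F n i) = (d n).sideCellVolume i.succ
  cellVolume_pos : ∀ n, 0 < (d n).cellVolume
  index_ne_zero : ∀ n i, (d n).index i ≠ 0
  productIndex_ne_zero : ∀ n, (d n).productIndex ≠ 0
  discrete_product : ∀ n, DiscreteTopology (d n).product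
  radius_pos : ∀ᶠ n in atTop, 0 < (d n).radius
  tendsto_div : ∀ i, Tendsto (fun n => ρ n i / (d n).radius) atTop (𝓝 0)

lemma SmallTiles.exists_epsilon (h : SmallTiles d F ρ) :
    ∃ ε : ℕ → ℝ, Tendsto ε atTop (𝓝 0) ∧ ∀ᶠ n in atTop, 0 < (d n).radius ∧ 0 ≤ ε n ∧
      2 * ε n < 1 ∧ ∀ i, ρ n i ≤ ε n * (d n).radius := by
  -- The sum of the ratios is one ε that dominates every ratio.
  have hε : Tendsto (fun n => ∑ i, ρ n i / (d n).radius) atTop (𝓝 0) := by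
    simpa using tendsto_finsetSum Finset.univ fun i _ => h.tendsto_div i
  refine ⟨_, hε, ?_⟩
  filter_upwards [h.radius_pos, hε.eventually_lt_const (by norm_num : (0:ℝ) < 1 / 2)] with n hr h2
  have h0 : ∀ i ∈ Finset.univ, 0 ≤ ρ n i / (d n).radius := fun i _ =>
    div_nonneg (h.isTile n i).nonneg hr.le
  refine ⟨hr, Finset.sum_nonneg h0, by linarith, fun i => ?_⟩
  rw [← div_le_iff₀ hr]
  exact Finset.single_le_sum h0 (Finset.mem_univ i)

lemma SmallTiles.tendsto_fillRatio (h : SmallTiles d F ρ) :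
    Tendsto (fun n => (d n).fillRatio) atTop (𝓝 1) := by
  obtain ⟨ε, hε, hev⟩ := h.exists_epsilon
  have h1 : Tendsto (fun n => ((1 + 2 * ε n) ^ (k * L))⁻¹) atTop (𝓝 1) := by
    have := ((((hε.const_mul 2).const_add 1).pow (k * L)).inv₀ (by simp))
    simpa using this
  have h2 : Tendsto (fun n => ((1 - 2 * ε n) ^ (k * L))⁻¹) atTop (𝓝 1) := by
    have := ((((hε.const_mul 2).const_sub 1).pow (k * L)).inv₀ (by simp))
    simpa using this
  refine tendsto_of_tendsto_of_tendsto_of_le_of_le' h1 h2 ?_ ?_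
  · filter_upwards [hev] with n hn
    exact ((d n).fillRatio_bounds (h.isTile n) (h.volume_eq n) (h.index_ne_zero n 0) hn.1 hn.2.1
      hn.2.2.2 hn.2.2.1).1
  · filter_upwards [hev] with n hn
    exact ((d n).fillRatio_bounds (h.isTile n) (h.volume_eq n) (h.index_ne_zero n 0) hn.1 hn.2.1
      hn.2.2.2 hn.2.2.1).2

lemma SmallTiles.tendsto_labelSum (h : SmallTiles d F ρ) (i j : Fin (k + 1)) :
    Tendsto (fun n => (d n).labelSum i j / ((d n).productIndex * (d n).radius ^ 2)) atTop
      (𝓝 (bodyMoment k L i j / bodyVolume k L)) := by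
  obtain ⟨ε, hε, hev⟩ := h.exists_epsilon
  have hQ := h.tendsto_fillRatio
  have hp : Tendsto (fun n => 1 + 2 * ε n) atTop (𝓝 1) := by
    simpa using (hε.const_mul 2).const_add 1
  have hm : Tendsto (fun n => 1 - 2 * ε n) atTop (𝓝 1) := by
    simpa using (hε.const_mul 2).const_sub 1
  have h1 := hQ.mul (((hp.pow (k * L + 2)).mul_const (bodyMoment k L i j / bodyVolume k L)).add
    ((((hε.const_mul 4).mul hp).add ((hε.pow 2).const_mul 4)).mul (hp.pow (k * L))))
  have h2 := (hQ.mul (((hm.pow (k * L + 2)).mul_const (bodyMoment k L i j / bodyVolume k L)).sub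
    ((hε.const_mul 4).mul (hm.pow (k * L))))).sub ((hQ.mul (hp.pow (k * L))).sub_const 1)
  have e1 : (1:ℝ) * (1 ^ (k * L + 2) * (bodyMoment k L i j / bodyVolume k L) +
      (4 * 0 * 1 + 4 * 0 ^ 2) * 1 ^ (k * L)) = bodyMoment k L i j / bodyVolume k L := by
    simp
  have e2 : (1:ℝ) * (1 ^ (k * L + 2) * (bodyMoment k L i j / bodyVolume k L) -
      4 * 0 * 1 ^ (k * L)) - (1 * 1 ^ (k * L) - 1) = bodyMoment k L i j / bodyVolume k L := by
    simp
  rw [e1] at h1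
  rw [e2] at h2
  refine tendsto_of_tendsto_of_tendsto_of_le_of_le' h2 h1 ?_ ?_
  · filter_upwards [hev] with n hn
    have := h.discrete_product n
    exact ((d n).labelSum_div_bounds (h.productIndex_ne_zero n) (h.isTile n) (h.volume_eq n)
      (h.index_ne_zero n 0) hn.1 hn.2.1 hn.2.2.2 hn.2.2.1 i j).2
  · filter_upwards [hev] with n hn
    have := h.discrete_product n
    exact ((d n).labelSum_div_bounds (h.productIndex_ne_zero n) (h.isTile n) (h.volume_eq n)
      (h.index_ne_zero n 0) hn.1 hn.2.1 hn.2.2.2 hn.2.2.1 i j).1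

lemma SmallTiles.tendsto_ballVolume (h : SmallTiles d F ρ) (hk : 0 < k) (hL : 0 < L) :
    Tendsto (fun n => (d n).ballVolume / (d n).predictedBallVolume) atTop (𝓝 1) := by
  have h1 := h.tendsto_fillRatio.rpow_const (p := ((k : ℝ)⁻¹)) (Or.inl one_ne_zero)
  rw [Real.one_rpow] at h1
  refine h1.congr' ?_
  filter_upwards [h.radius_pos] with n hr
  rw [← (d n).ballVolume_div_pow hk hL (h.cellVolume_pos n) (h.index_ne_zero n)]
  refine Real.pow_rpow_inv_natCast (div_nonneg ?_ ?_) hk.ne'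
  · exact mul_nonneg (unitBallVolume_pos L).le (pow_nonneg hr.le _)
  · exact ((d n).predictedBallVolume_pos (h.cellVolume_pos n) (h.index_ne_zero n)).le

lemma SmallTiles.tendsto_pairDistortion (h : SmallTiles d F ρ) (hk : 0 < k) (hL : 0 < L)
    (i j : Fin (k + 1)) :
    Tendsto (fun n => (d n).pairDistortion i j / (d n).predictedDistortion) atTop
      (𝓝 (bodyMoment k L i j / bodyVolume k L *
        (unitBallVolume L / ∫ x in Metric.closedBall (0 : Space L) 1, ‖x‖ ^ 2))) := by
  have h1 := (h.tendsto_ballVolume hk hL).rpow_const (p := 2 / (L : ℝ)) (Or.inl one_ne_zero)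
  have h2 := (h.tendsto_labelSum i j).mul (h1.mul_const
    (unitBallVolume L / ∫ x in Metric.closedBall (0 : Space L) 1, ‖x‖ ^ 2))
  rw [Real.one_rpow, one_mul] at h2
  refine h2.congr' ?_
  filter_upwards [h.radius_pos] with n hr
  exact ((d n).pairDistortion_div hL (h.cellVolume_pos n) (h.index_ne_zero n) hr i j).symm

end Limits

/-! ### The tiles are small compared with the radius -/

lemma HighResolution.exists_tiles {k L : ℕ} {M : Submodule ℤ (Space L)} [DiscreteTopology M]
    [IsZLattice ℝ M] {d : ℕ → AsymmetricDesign (k + 1) L} (h : HighResolution M d) :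
    ∃ (D : ℝ) (c : ℕ → Fin k → ℝ) (F : ℕ → Fin k → Set (Space L)),
      (∀ n i, 0 < c n i ∧ c n i ^ L * ZLattice.covolume M = (d n).sideCellVolume i.succ) ∧
      ((∀ᶠ n in atTop, 0 < (d n).radius) →
        (∀ i, Tendsto (fun n => c n i * D / (d n).radius) atTop (𝓝 0)) →
        SmallTiles d F fun n i => c n i * D) ∧
      (∀ n i, IsTile ((d n).side i.succ) (F n i) (c n i * D)) ∧
      (∀ n i, volume.real (F n i) = (d n).sideCellVolume i.succ) ∧
      (∀ n, 0 < (d n).cellVolume) ∧ ∀ n i, (d n).index i ≠ 0 := by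
  obtain ⟨D, hD⟩ := exists_tile M
  have hcen := fun n => hD (d n).central (h.similar n)
  have hprod := fun n => hD (d n).product ((h.similar n).trans (d n).product_similar)
  have hside := fun n i => hD ((d n).side i) ((h.similar n).trans ((d n).side_similar i))
  have hcv : ∀ n i, ZLattice.covolume ((d n).side i) = (d n).sideCellVolume i := fun n i => by
    obtain ⟨_, _, -⟩ := hcen n
    obtain ⟨_, _, -⟩ := hside n i
    exact covolume_eq_latticeIndex_mul ((d n).side_le i)
  have hpos : ∀ n, 0 < (d n).cellVolume := fun n => by
    obtain ⟨_, _, -⟩ := hcen n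
    exact ZLattice.covolume_pos _ volume
  have hidx : ∀ n i, (d n).index i ≠ 0 := fun n i => by
    obtain ⟨_, _, -⟩ := hcen n
    obtain ⟨_, _, -⟩ := hside n i
    exact latticeIndex_ne_zero ((d n).side_le i)
  have hpidx : ∀ n, (d n).productIndex ≠ 0 := fun n => by
    obtain ⟨_, _, -⟩ := hcen n
    obtain ⟨_, _, -⟩ := hprod n
    exact latticeIndex_ne_zero (d n).product_le_central
  choose hdisc hlat c hc hcvol F hF hvol using hside
  have hv : ∀ n (i : Fin k), volume.real (F n i.succ) = (d n).sideCellVolume i.succ :=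
    fun n i => (hvol n i.succ).trans (hcv n i.succ)
  refine ⟨D, fun n i => c n i.succ, fun n i => F n i.succ,
    fun n i => ⟨hc n i.succ, (hcvol n i.succ).symm.trans (hcv n i.succ)⟩, fun hr ht => ?_,
    fun n i => hF n i.succ, hv, hpos, hidx⟩
  exact ⟨fun n i => hF n i.succ, hv, hpos, hidx, hpidx,
    fun n => by obtain ⟨hd, -⟩ := hprod n; exact hd, hr, ht⟩

/-- Reduces smallness of the tiles to a statement on numbers. With X_i = (r/c_i)^L, similarity gives
X_i N_i = r^L · covol(M)/ν for every i, and the crude count bounds N₀ by the product of the C(1 +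
X_i). The hypothesis `hX` is what remains to be checked for each K. -/
lemma HighResolution.exists_smallTiles {k L : ℕ} {M : Submodule ℤ (Space L)} [DiscreteTopology M]
    [IsZLattice ℝ M] {d : ℕ → AsymmetricDesign (k + 1) L} (h : HighResolution M d)
    (hk : 0 < k) (hL : 0 < L)
    (hX : ∀ (C : ℝ) (X : ℕ → Fin k → ℝ) (Y : ℕ → ℝ), (∀ n i, 0 ≤ X n i) →
      (∀ n i, X n i * (d n).index i.succ = Y n) →
      (∀ n, ((d n).index 0 : ℝ) ≤ ∏ i, C * (1 + X n i)) →
      ∀ i, Tendsto (fun n => X n i) atTop atTop) :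
    ∃ F ρ, SmallTiles d F ρ := by
  obtain ⟨D, c, F, hc, hsmall, hF, hv, hν, hN⟩ := h.exists_tiles
  have hA : 0 < ZLattice.covolume M := ZLattice.covolume_pos M volume
  have hω := unitBallVolume_pos L
  have hr := fun n => (d n).radius_nonneg (hN n 0)
  have hD : 0 ≤ D := by
    have := (hF 0 ⟨0, hk⟩).nonneg
    exact nonneg_of_mul_nonneg_right this (hc 0 ⟨0, hk⟩).1
  -- The constant comes from (a + D)^L ≤ 2^(L−1)(a^L + D^L) ≤ 2^(L−1)(1 + D^L)(1 + a^L) with a =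
  -- r/c_i.
  have hX' := hX (2 ^ (L - 1) * (1 + D ^ L) * unitBallVolume L / ZLattice.covolume M)
    (fun n i => ((d n).radius / c n i) ^ L)
    (fun n => (d n).radius ^ L * ZLattice.covolume M / (d n).cellVolume)
    (fun n i => pow_nonneg (div_nonneg (hr n) (hc n i).1.le) L) ?_ ?_
  · have hR : ∀ i, Tendsto (fun n => (d n).radius / c n i) atTop atTop := fun i => by
      have h1 := (tendsto_rpow_atTop (y := (L : ℝ)⁻¹) (by positivity)).comp (hX' i)
      refine h1.congr fun n => ?_
      exact Real.pow_rpow_inv_natCast (div_nonneg (hr n) (hc n i).1.le) hL.ne'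
    refine ⟨F, _, hsmall ?_ fun i => ?_⟩
    · filter_upwards [(hR ⟨0, hk⟩).eventually_gt_atTop 0] with n hn
      refine lt_of_le_of_ne (hr n) fun h0 => ?_
      rw [← h0, zero_div] at hn
      exact lt_irrefl _ hn
    · have h1 := (hR i).inv_tendsto_atTop.const_mul D
      rw [mul_zero] at h1
      refine h1.congr fun n => ?_
      rw [Pi.inv_apply, inv_div]
      ring
  · intro n i
    have hci := (hc n i).1
    have h1 := (hc n i).2
    have hν' := hν n
    rw [AsymmetricDesign.sideCellVolume] at h1
    rw [div_pow, div_mul_eq_mul_div, div_eq_div_iff (pow_pos hci L).ne' hν'.ne', mul_assoc, ← h1]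
    ring
  · intro n
    have h1 := (d n).index_mul_le_prod (hF n) (hN n 0)
    have hV : 0 < ∏ i, volume.real (F n i) :=
      Finset.prod_pos fun i _ => (hF n i).volume_pos
    rw [mul_comm, ← le_div_iff₀ hV, ← Finset.prod_div_distrib] at h1
    refine h1.trans (Finset.prod_le_prod (fun i _ => ?_) fun i _ => ?_)
    · have := (hF n i).nonneg
      have := hr n
      have := (hF n i).volume_pos
      positivity
    · have hci := (hc n i).1
      rw [hv, ← (hc n i).2, div_le_iff₀ (mul_pos (pow_pos hci L) hA)]
      have hR : 0 ≤ (d n).radius / c n i := div_nonneg (hr n) hci.le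
      have h2 : (d n).radius + c n i * D = c n i * ((d n).radius / c n i + D) := by
        field_simp
      have h3 := add_pow_le hR hD L
      have hDL : 0 ≤ D ^ L := pow_nonneg hD L
      have hXL : 0 ≤ ((d n).radius / c n i) ^ L := pow_nonneg hR L
      have h4 : ((d n).radius / c n i + D) ^ L ≤
          2 ^ (L - 1) * ((1 + D ^ L) * (1 + ((d n).radius / c n i) ^ L)) :=
        h3.trans (mul_le_mul_of_nonneg_left (by nlinarith [mul_nonneg hDL hXL]) (by positivity))
      rw [h2, mul_pow]
      have h5 := mul_le_mul_of_nonneg_left h4 (mul_pos (pow_pos hci L) hω).le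
      refine le_trans (le_of_eq (by ring)) (h5.trans (le_of_eq ?_))
      field_simp

lemma HighResolution.exists_smallTiles_two {L : ℕ} {M : Submodule ℤ (Space L)}
    [DiscreteTopology M] [IsZLattice ℝ M] {d : ℕ → AsymmetricDesign (1 + 1) L}
    (h : HighResolution M d) (hL : 0 < L) : ∃ F ρ, SmallTiles d F ρ := by
  refine h.exists_smallTiles one_pos hL fun C X Y hX _ hle i => ?_
  have h0 : Tendsto (fun n => ((d n).index 0 : ℝ)) atTop atTop :=
    tendsto_natCast_atTop_atTop.comp (h.index_tendsto 0)
  rw [tendsto_atTop]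
  intro b
  filter_upwards [h0.eventually_gt_atTop (|C| * (1 + |b|))] with n hn
  have h1 := hle n
  rw [Fin.prod_univ_one] at h1
  rw [Subsingleton.elim i 0]
  by_contra! hlt
  have h2 := hX n 0
  have h3 : C * (1 + X n 0) ≤ |C| * (1 + |b|) :=
    mul_le_mul (le_abs_self C) (by linarith [le_abs_self b]) (by linarith) (abs_nonneg C)
  linarith

/-- If X₂ ≤ |b|, then X₁ = X₂N₂/N₁ gives 1 ≤ |C|(1 + |b|)²(1/N₀ + N₂/(N₀N₁)), whose right side tends
to 0. -/
lemma tendsto_atTop_of_le_mul {N₀ N₁ N₂ X₁ X₂ : ℕ → ℝ} {C : ℝ} (h0 : Tendsto N₀ atTop atTop)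
    (hN₁ : ∀ n, 0 < N₁ n) (hX₂ : ∀ n, 0 ≤ X₂ n)
    (hY : ∀ n, X₁ n * N₁ n = X₂ n * N₂ n) (hN₂ : ∀ n, 0 < N₂ n)
    (hle : ∀ n, N₀ n ≤ C * ((1 + X₁ n) * (1 + X₂ n)))
    (hfill : Tendsto (fun n => N₂ n / (N₀ n * N₁ n)) atTop (𝓝 0)) :
    Tendsto X₂ atTop atTop := by
  have hη : Tendsto (fun n => (N₀ n)⁻¹ + N₂ n / (N₀ n * N₁ n)) atTop (𝓝 0) := by
    simpa using h0.inv_tendsto_atTop.add hfill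
  rw [tendsto_atTop]
  intro b
  have hη' := (hη.const_mul (|C| * (1 + |b|) ^ 2)).eventually_lt_const
    (u := 1) (by rw [mul_zero]; exact one_pos)
  filter_upwards [hη', h0.eventually_gt_atTop 0] with n hn hn0
  by_contra! hlt
  have hX₁ : X₁ n = X₂ n * N₂ n / N₁ n := by rw [← hY, mul_div_cancel_right₀ _ (hN₁ n).ne']
  have h1 := hle n
  have hb : X₂ n ≤ |b| := hlt.le.trans (le_abs_self b)
  have hX₂' := hX₂ n
  have ha : 0 ≤ N₂ n / (N₀ n * N₁ n) := (div_pos (hN₂ n) (mul_pos hn0 (hN₁ n))).le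
  have hi : 0 ≤ (N₀ n)⁻¹ := (inv_pos.2 hn0).le
  have hX₁' : 0 ≤ X₁ n := by
    rw [hX₁]
    exact div_nonneg (mul_nonneg hX₂' (hN₂ n).le) (hN₁ n).le
  have h2 : (1 + X₁ n) / N₀ n = (N₀ n)⁻¹ + X₂ n * (N₂ n / (N₀ n * N₁ n)) := by
    rw [hX₁]
    have := (hN₁ n).ne'
    field_simp
  have h3 : (1 + X₁ n) / N₀ n ≤ (1 + |b|) * ((N₀ n)⁻¹ + N₂ n / (N₀ n * N₁ n)) := by
    rw [h2]
    nlinarith [mul_le_mul_of_nonneg_right hb ha, mul_nonneg (abs_nonneg b) hi]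
  have h4 : 1 ≤ |C| * ((1 + X₁ n) / N₀ n * (1 + X₂ n)) := by
    have : N₀ n / N₀ n ≤ |C| * ((1 + X₁ n) * (1 + X₂ n)) / N₀ n := by
      refine div_le_div_of_nonneg_right (h1.trans ?_) hn0.le
      exact mul_le_mul_of_nonneg_right (le_abs_self C) (by positivity)
    rw [div_self hn0.ne'] at this
    refine this.trans (le_of_eq ?_)
    ring
  have h5 : (1 + X₁ n) / N₀ n * (1 + X₂ n) ≤
      (1 + |b|) * ((N₀ n)⁻¹ + N₂ n / (N₀ n * N₁ n)) * (1 + |b|) :=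
    mul_le_mul h3 (by linarith) (by linarith) (by positivity)
  have h6 := mul_le_mul_of_nonneg_left h5 (abs_nonneg C)
  nlinarith

/-- For K = 3 the exponent is 1/2. Squaring removes the roots, and N_i²/(N₀N₁N₂) is then N₂/(N₀N₁)
or N₁/(N₀N₂). -/
lemma FillsBalls.tendsto_sq {L : ℕ} {d : ℕ → AsymmetricDesign (2 + 1) L} (h : FillsBalls d)
    {i : Fin (2 + 1)} (hi : i ≠ 0) :
    Tendsto (fun n => ((d n).index i : ℝ) ^ 2 / ∏ m, ((d n).index m : ℝ)) atTop (𝓝 0) := by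
  have h1 := (h i hi).pow 2
  rw [zero_pow two_ne_zero] at h1
  refine h1.congr fun n => ?_
  rw [div_pow, ← Finset.prod_pow]
  congr 1
  refine Finset.prod_congr rfl fun m _ => ?_
  have h2 : (1 / (((2 + 1 : ℕ) : ℝ) - 1)) = ((2 : ℕ) : ℝ)⁻¹ := by norm_num
  rw [h2, Real.rpow_inv_natCast_pow (Nat.cast_nonneg _) two_ne_zero]

lemma HighResolution.exists_smallTiles_three {L : ℕ} {M : Submodule ℤ (Space L)}
    [DiscreteTopology M] [IsZLattice ℝ M] {d : ℕ → AsymmetricDesign (2 + 1) L}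
    (h : HighResolution M d) (hfill : FillsBalls d) (hL : 0 < L) : ∃ F ρ, SmallTiles d F ρ := by
  have hN : ∀ n i, (0 : ℝ) < (d n).index i := fun n i => by
    obtain ⟨-, -, -, -, -, -, -, -, hN⟩ := h.exists_tiles
    exact Nat.cast_pos.2 (Nat.pos_of_ne_zero (hN n i))
  refine h.exists_smallTiles two_pos hL fun C X Y hX hY hle i => ?_
  have h0 : Tendsto (fun n => ((d n).index 0 : ℝ)) atTop atTop :=
    tendsto_natCast_atTop_atTop.comp (h.index_tendsto 0)
  have hle' : ∀ n, ((d n).index 0 : ℝ) ≤ C * C * ((1 + X n 0) * (1 + X n 1)) := fun n => by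
    refine (hle n).trans_eq ?_
    rw [Fin.prod_univ_two]
    ring
  have hYY : ∀ n, X n 0 * ((d n).index 1 : ℝ) = X n 1 * ((d n).index 2 : ℝ) := fun n =>
    (hY n 0).trans (hY n 1).symm
  have h1 : Tendsto (fun n => X n 1) atTop atTop := by
    refine tendsto_atTop_of_le_mul (C := C * C) h0 (fun n => hN n 1) (fun n => hX n 1) hYY (fun n => hN n 2)
      hle' ((hfill.tendsto_sq (i := 2) (by decide)).congr fun n => ?_)
    have := hN n 0
    have := hN n 1
    have := hN n 2
    rw [Fin.prod_univ_three]
    field_simp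
  have h2 : Tendsto (fun n => X n 0) atTop atTop := by
    refine tendsto_atTop_of_le_mul (C := C * C) h0 (fun n => hN n 2) (fun n => hX n 0) (fun n => (hYY n).symm)
      (fun n => hN n 1) (fun n => (hle' n).trans_eq (by ring))
      ((hfill.tendsto_sq (i := 1) (by decide)).congr fun n => ?_)
    have := hN n 0
    have := hN n 1
    have := hN n 2
    rw [Fin.prod_univ_three]
    field_simp
  fin_cases i
  · exact h2
  · exact h1

/-! ### The moments for one and for two free points -/

lemma norm_withOrigin_one {L : ℕ} (x : Fin 1 → Space L) {i j : Fin (1 + 1)} (hij : i ≠ j) :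
    ‖withOrigin x i - withOrigin x j‖ = ‖x 0‖ := by
  have h0 : withOrigin x 0 = 0 := rfl
  have h1 : withOrigin x 1 = x 0 := rfl
  fin_cases i <;> fin_cases j <;> simp_all

lemma tupleBody_one (L : ℕ) :
    tupleBody 1 L 1 = (fun x : Fin 1 → Space L => x 0) ⁻¹' Metric.closedBall 0 1 := by
  ext x
  rw [mem_tupleBody_iff zero_le_one]
  simp [Fin.forall_fin_one]

lemma bodyVolume_one (L : ℕ) : bodyVolume 1 L = unitBallVolume L := by
  rw [bodyVolume, tupleBody_one, Measure.real, unitBallVolume]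
  congr 1
  exact (volume_preserving_funUnique (Fin 1) (Space L)).measure_preimage
    measurableSet_closedBall.nullMeasurableSet

lemma bodyMoment_one (L : ℕ) {i j : Fin (1 + 1)} (hij : i ≠ j) :
    bodyMoment 1 L i j = ∫ x in Metric.closedBall (0 : Space L) 1, ‖x‖ ^ 2 := by
  rw [bodyMoment, tupleBody_one]
  simp only [norm_withOrigin_one _ hij]
  exact (volume_preserving_funUnique (Fin 1) (Space L)).setIntegral_preimage_emb
    (MeasurableEquiv.funUnique (Fin 1) (Space L)).measurableEmbedding (fun x => ‖x‖ ^ 2)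
    (Metric.closedBall 0 1)

/-- The pairs of points that have, together with the origin, mutual distances at most `1`. -/
def pairBody (L : ℕ) : Set (Space L × Space L) :=
  {p | ‖p.1‖ ≤ 1 ∧ ‖p.2‖ ≤ 1 ∧ ‖p.1 - p.2‖ ≤ 1}

lemma tupleBody_two (L : ℕ) :
    tupleBody 2 L 1 = (fun x : Fin 2 → Space L => (x 0, x 1)) ⁻¹' pairBody L := by
  ext x
  rw [mem_tupleBody_iff zero_le_one]
  simp only [Fin.forall_fin_two, pairBody, Set.mem_preimage, Set.mem_ofPred_eq, sub_self,
    norm_zero, norm_sub_rev (x 1) (x 0)]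
  have := zero_le_one (α := ℝ)
  tauto

lemma isCompact_pairBody (L : ℕ) : IsCompact (pairBody L) := by
  apply Metric.isCompact_of_isClosed_isBounded
  · have h1 : IsClosed {p : Space L × Space L | ‖p.1‖ ≤ 1} :=
      isClosed_le (by fun_prop) continuous_const
    have h2 : IsClosed {p : Space L × Space L | ‖p.2‖ ≤ 1} :=
      isClosed_le (by fun_prop) continuous_const
    have h3 : IsClosed {p : Space L × Space L | ‖p.1 - p.2‖ ≤ 1} :=
      isClosed_le (by fun_prop) continuous_const
    exact h1.inter (h2.inter h3)
  · refine (Metric.isBounded_closedBall (x := (0 : Space L × Space L)) (r := 1)).subset ?_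
    intro p hp
    rw [mem_closedBall_zero_iff, Prod.norm_def]
    exact max_le hp.1 hp.2.1

lemma measurableSet_pairBody (L : ℕ) : MeasurableSet (pairBody L) :=
  (isCompact_pairBody L).measurableSet

lemma bodyVolume_two (L : ℕ) : bodyVolume 2 L = volume.real (pairBody L) := by
  rw [bodyVolume, tupleBody_two, Measure.real, Measure.real]
  congr 1
  exact (volume_preserving_finTwoArrow (Space L)).measure_preimage
    (measurableSet_pairBody L).nullMeasurableSet

lemma setIntegral_tupleBody_two (L : ℕ) (f : Space L × Space L → ℝ) :
    ∫ x in tupleBody 2 L 1, f (x 0, x 1) = ∫ p in pairBody L, f p := by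
  rw [tupleBody_two]
  exact (volume_preserving_finTwoArrow (Space L)).setIntegral_preimage_emb
    (MeasurableEquiv.finTwoArrow (α := Space L)).measurableEmbedding f (pairBody L)

lemma setIntegral_pairBody_swap (L : ℕ) :
    ∫ p in pairBody L, ‖p.2‖ ^ 2 = ∫ p in pairBody L, ‖p.1‖ ^ 2 := by
  have h := (Measure.measurePreserving_swap (μ := (volume : Measure (Space L)))
    (ν := (volume : Measure (Space L)))).setIntegral_preimage_emb
    MeasurableEquiv.prodComm.measurableEmbedding (fun p => ‖p.1‖ ^ 2) (pairBody L)
  have hpre : Prod.swap ⁻¹' pairBody L = pairBody L := by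
    ext p
    simp only [pairBody, Set.mem_preimage, Set.mem_ofPred_eq, Prod.fst_swap, Prod.snd_swap,
      norm_sub_rev p.2 p.1]
    tauto
  rw [hpre] at h
  exact h

/-- The map (x, y) ↦ (x − y, −y) translates the triangle 0, x, y so that y becomes the origin; it is
a volume-preserving involution of the body. -/
lemma setIntegral_pairBody_sub (L : ℕ) :
    ∫ p in pairBody L, ‖p.1 - p.2‖ ^ 2 = ∫ p in pairBody L, ‖p.1‖ ^ 2 := by
  have hmp : MeasurePreserving (fun p : Space L × Space L => (p.1 - p.2, -p.2)) volume volume :=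
    ((MeasurePreserving.id (volume : Measure (Space L))).prod
      (Measure.measurePreserving_neg (volume : Measure (Space L)))).comp
      (measurePreserving_sub_prod volume volume)
  have hinv : Function.Involutive fun p : Space L × Space L => (p.1 - p.2, -p.2) := fun p => by
    simp
  have h := hmp.setIntegral_preimage_emb
    (MeasurableEquiv.ofInvolutive _ hinv hmp.measurable).measurableEmbedding
    (fun p => ‖p.1‖ ^ 2) (pairBody L)
  have hpre : (fun p : Space L × Space L => (p.1 - p.2, -p.2)) ⁻¹' pairBody L = pairBody L := by
    ext p
    simp only [pairBody, Set.mem_preimage, Set.mem_ofPred_eq, norm_neg, sub_neg_eq_add,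
      sub_add_cancel]
    tauto
  rw [hpre] at h
  exact h

lemma bodyMoment_two (L : ℕ) {i j : Fin (2 + 1)} (hij : i ≠ j) :
    bodyMoment 2 L i j = ∫ p in pairBody L, ‖p.1‖ ^ 2 := by
  have h01 : ∫ x in tupleBody 2 L 1, ‖x 0‖ ^ 2 = ∫ p in pairBody L, ‖p.1‖ ^ 2 :=
    setIntegral_tupleBody_two L fun p => ‖p.1‖ ^ 2
  have h02 : ∫ x in tupleBody 2 L 1, ‖x 1‖ ^ 2 = ∫ p in pairBody L, ‖p.1‖ ^ 2 :=
    (setIntegral_tupleBody_two L fun p => ‖p.2‖ ^ 2).trans (setIntegral_pairBody_swap L)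
  have h12 : ∫ x in tupleBody 2 L 1, ‖x 0 - x 1‖ ^ 2 = ∫ p in pairBody L, ‖p.1‖ ^ 2 :=
    (setIntegral_tupleBody_two L fun p => ‖p.1 - p.2‖ ^ 2).trans (setIntegral_pairBody_sub L)
  have e0 : ∀ x : Fin 2 → Space L, withOrigin x 0 = 0 := fun _ => rfl
  have e1 : ∀ x : Fin 2 → Space L, withOrigin x 1 = x 0 := fun _ => rfl
  have e2 : ∀ x : Fin 2 → Space L, withOrigin x 2 = x 1 := fun _ => rfl
  have hsymm : ∀ i j, bodyMoment 2 L i j = bodyMoment 2 L j i := fun i j => by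
    simp only [bodyMoment, norm_sub_rev]
  have a01 : bodyMoment 2 L 0 1 = ∫ p in pairBody L, ‖p.1‖ ^ 2 := by
    simp only [bodyMoment, e0, e1, zero_sub, norm_neg, h01]
  have a02 : bodyMoment 2 L 0 2 = ∫ p in pairBody L, ‖p.1‖ ^ 2 := by
    simp only [bodyMoment, e0, e2, zero_sub, norm_neg, h02]
  have a12 : bodyMoment 2 L 1 2 = ∫ p in pairBody L, ‖p.1‖ ^ 2 := by
    simp only [bodyMoment, e1, e2, h12]
  fin_cases i <;> fin_cases j
  · exact absurd rfl hij
  · exact a01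
  · exact a02
  · exact (hsymm _ _).trans a01
  · exact absurd rfl hij
  · exact a12
  · exact (hsymm _ _).trans a02
  · exact (hsymm _ _).trans a12
  · exact absurd rfl hij

/-! ### Concentration of the mutual distances in high dimension -/

open scoped RealInnerProductSpace

/-- The reflection exchanging `x` and `y` preserves `B`. -/
lemma setIntegral_inner_sq_eq {L : ℕ} {B : Set (Space L)}
    (hB : ∀ U : Space L ≃ₗᵢ[ℝ] Space L, U ⁻¹' B = B) {x y : Space L} (h : ‖x‖ = ‖y‖) :
    ∫ u in B, ⟪x, u⟫ ^ 2 = ∫ u in B, ⟪y, u⟫ ^ 2 := by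
  let R := Submodule.reflection (ℝ ∙ (x - y))ᗮ
  have hR : R x = y := Submodule.reflection_sub h
  have h1 := R.measurePreserving.setIntegral_preimage_emb
    R.toMeasurableEquiv.measurableEmbedding (fun u => ⟪y, u⟫ ^ 2) B
  rw [hB] at h1
  rw [← h1]
  congr 1
  ext u
  rw [← hR, R.inner_map_map]

/-- All directions have the same second moment, so each carries the share 1/L of ∫‖u‖². -/
lemma setIntegral_inner_sq {L : ℕ} {B : Set (Space L)} (hBm : IsCompact B)
    (hB : ∀ U : Space L ≃ₗᵢ[ℝ] Space L, U ⁻¹' B = B) (x : Space L) :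
    L * ∫ u in B, ⟪x, u⟫ ^ 2 = ‖x‖ ^ 2 * ∫ u in B, ‖u‖ ^ 2 := by
  have h1 : ∀ i : Fin L, ∫ u in B, ⟪x, u⟫ ^ 2 =
      ∫ u in B, ‖x‖ ^ 2 * ⟪EuclideanSpace.basisFun (Fin L) ℝ i, u⟫ ^ 2 := fun i => by
    rw [setIntegral_inner_sq_eq hB
      (y := ‖x‖ • EuclideanSpace.basisFun (Fin L) ℝ i) (by simp [norm_smul])]
    simp only [inner_smul_left, conj_trivial, mul_pow]
  have h2 : ∑ i : Fin L, ∫ u in B, ⟪x, u⟫ ^ 2 = ‖x‖ ^ 2 * ∫ u in B, ‖u‖ ^ 2 := by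
    rw [Finset.sum_congr rfl fun i _ => h1 i, ← integral_finsetSum, ← integral_const_mul]
    · congr 1
      ext u
      rw [← Finset.mul_sum]
      congr 1
      have := (EuclideanSpace.basisFun (Fin L) ℝ).sum_sq_norm_inner_right u
      simpa using this
    · intro i _
      exact Continuous.continuousOn (by fun_prop) |>.integrableOn_compact hBm
  rw [← h2]
  simp

/-- Chebyshev's inequality: in high dimension almost all of a ball is nearly orthogonal to `x`. -/
lemma volume_inner_gt_le {L : ℕ} (hL : 0 < L) {a δ : ℝ} (ha : a ≤ 1) (hδ : 0 < δ) {x : Space L}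
    (hx : ‖x‖ ≤ 1) :
    volume {u : Space L | ‖u‖ ^ 2 ≤ a ∧ δ < |⟪x, u⟫|} ≤
      ENNReal.ofReal (1 / (L * δ ^ 2)) * volume {u : Space L | ‖u‖ ^ 2 ≤ a} := by
  set B : Set (Space L) := {u | ‖u‖ ^ 2 ≤ a} with hBdef
  have hBc : IsCompact B := by
    apply Metric.isCompact_of_isClosed_isBounded
    · exact isClosed_le (by fun_prop) continuous_const
    · refine (Metric.isBounded_closedBall (x := (0 : Space L)) (r := 1)).subset fun u hu => ?_
      rw [mem_closedBall_zero_iff]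
      have hu : ‖u‖ ^ 2 ≤ a := hu
      exact (sq_le_one_iff₀ (norm_nonneg _)).1 (hu.trans ha)
  have hinv : ∀ U : Space L ≃ₗᵢ[ℝ] Space L, U ⁻¹' B = B := fun U => by
    ext u
    simp [hBdef]
  have hfin : volume B ≠ ⊤ := hBc.measure_lt_top.ne
  have hsub : {u : Space L | ‖u‖ ^ 2 ≤ a ∧ δ < |⟪x, u⟫|} ⊆ B := fun u hu => hu.1
  have hfin' := ((measure_mono hsub).trans_lt hfin.lt_top).ne
  have hint : IntegrableOn (fun u => ⟪x, u⟫ ^ 2) B :=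
    Continuous.continuousOn (by fun_prop) |>.integrableOn_compact hBc
  have h1 : δ ^ 2 * volume.real {u : Space L | ‖u‖ ^ 2 ≤ a ∧ δ < |⟪x, u⟫|} ≤
      ∫ u in B, ⟪x, u⟫ ^ 2 := by
    have ho : MeasurableSet {u : Space L | δ < |⟪x, u⟫|} :=
      (isOpen_lt continuous_const (by fun_prop)).measurableSet
    have hm : MeasurableSet {u : Space L | ‖u‖ ^ 2 ≤ a ∧ δ < |⟪x, u⟫|} :=
      hBc.measurableSet.inter ho
    calc _ = ∫ _ in {u : Space L | ‖u‖ ^ 2 ≤ a ∧ δ < |⟪x, u⟫|}, δ ^ 2 := by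
          rw [setIntegral_const, smul_eq_mul, mul_comm]
      _ ≤ ∫ u in {u : Space L | ‖u‖ ^ 2 ≤ a ∧ δ < |⟪x, u⟫|}, ⟪x, u⟫ ^ 2 :=
          setIntegral_mono_on (integrableOn_const hfin') (hint.mono_set hsub) hm fun u hu => by
            rw [← sq_abs ⟪x, u⟫]
            exact pow_le_pow_left₀ hδ.le hu.2.le 2
      _ ≤ _ := setIntegral_mono_set hint (Eventually.of_forall fun u => sq_nonneg _)
          hsub.eventuallyLE
  have h2 : ∫ u in B, ‖u‖ ^ 2 ≤ volume.real B := by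
    have := setIntegral_mono_on (μ := volume) (s := B) (f := fun u => ‖u‖ ^ 2)
      (g := fun _ => (1 : ℝ))
      (Continuous.continuousOn (by fun_prop) |>.integrableOn_compact hBc)
      (integrableOn_const hfin) hBc.measurableSet fun u hu => le_trans hu ha
    simpa using this
  have h3 := setIntegral_inner_sq hBc hinv x
  have h4 : ‖x‖ ^ 2 * ∫ u in B, ‖u‖ ^ 2 ≤ volume.real B := by
    have h5 : ‖x‖ ^ 2 ≤ 1 := pow_le_one₀ (norm_nonneg _) hx
    have h6 : 0 ≤ volume.real B := measureReal_nonneg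
    nlinarith [sq_nonneg ‖x‖]
  have hL' : (0 : ℝ) < L := Nat.cast_pos.2 hL
  have h7 : volume.real {u : Space L | ‖u‖ ^ 2 ≤ a ∧ δ < |⟪x, u⟫|} ≤
      1 / (L * δ ^ 2) * volume.real B := by
    rw [div_mul_eq_mul_div, one_mul, le_div_iff₀ (by positivity)]
    nlinarith
  rw [← ENNReal.ofReal_toReal hfin', ← ENNReal.ofReal_toReal hfin,
    ← ENNReal.ofReal_mul (by positivity)]
  exact ENNReal.ofReal_le_ofReal h7

/-- Pairs `(x, u)` with `‖x‖ ≤ s` and `‖u‖² + ‖x‖² / 4 ≤ a`. -/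
def ellipsoidBody (L : ℕ) (s a : ℝ) : Set (Space L × Space L) :=
  {p | ‖p.1‖ ≤ s ∧ ‖p.2‖ ^ 2 + ‖p.1‖ ^ 2 / 4 ≤ a}

lemma isCompact_ellipsoidBody (L : ℕ) (s a : ℝ) : IsCompact (ellipsoidBody L s a) := by
  apply Metric.isCompact_of_isClosed_isBounded
  · have h1 : IsClosed {p : Space L × Space L | ‖p.1‖ ≤ s} :=
      isClosed_le (by fun_prop) continuous_const
    have h2 : IsClosed {p : Space L × Space L | ‖p.2‖ ^ 2 + ‖p.1‖ ^ 2 / 4 ≤ a} :=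
      isClosed_le (by fun_prop) continuous_const
    exact h1.inter h2
  · refine (Metric.isBounded_closedBall (x := (0 : Space L × Space L))
      (r := max s (a + 1))).subset ?_
    intro p hp
    rw [mem_closedBall_zero_iff, Prod.norm_def]
    refine max_le_max hp.1 ?_
    have := hp.2
    nlinarith [sq_nonneg ‖p.1‖, sq_nonneg (‖p.2‖ - 1 / 2)]

lemma measurableSet_ellipsoidBody (L : ℕ) (s a : ℝ) : MeasurableSet (ellipsoidBody L s a) :=
  (isCompact_ellipsoidBody L s a).measurableSet

lemma measurableSet_lt_abs_inner (L : ℕ) (δ : ℝ) :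
    MeasurableSet {p : Space L × Space L | δ < |⟪p.1, p.2⟫|} :=
  (isOpen_lt continuous_const (by fun_prop)).measurableSet

lemma volume_ellipsoidBody_inner_gt_le {L : ℕ} (hL : 0 < L) {a δ : ℝ} (ha : a ≤ 1) (hδ : 0 < δ) :
    volume.real {p ∈ ellipsoidBody L 1 a | δ < |⟪p.1, p.2⟫|} ≤
      1 / (L * δ ^ 2) * volume.real (ellipsoidBody L 1 a) := by
  have hm : MeasurableSet {p ∈ ellipsoidBody L 1 a | δ < |⟪p.1, p.2⟫|} :=
    (measurableSet_ellipsoidBody L 1 a).inter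
      (measurableSet_lt_abs_inner L δ)
  have hfin := (isCompact_ellipsoidBody L 1 a).measure_lt_top (μ := volume)
  have key : volume {p ∈ ellipsoidBody L 1 a | δ < |⟪p.1, p.2⟫|} ≤
      ENNReal.ofReal (1 / (L * δ ^ 2)) * volume (ellipsoidBody L 1 a) := by
    rw [Measure.volume_eq_prod, Measure.prod_apply hm,
      Measure.prod_apply (measurableSet_ellipsoidBody L 1 a),
      ← lintegral_const_mul' _ _ ENNReal.ofReal_ne_top]
    refine lintegral_mono fun x => ?_
    by_cases hx : ‖x‖ ≤ 1
    · have h := volume_inner_gt_le hL (a := a - ‖x‖ ^ 2 / 4)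
        (by nlinarith [sq_nonneg ‖x‖]) hδ hx
      have e1 : Prod.mk x ⁻¹' {p ∈ ellipsoidBody L 1 a | δ < |⟪p.1, p.2⟫|} =
          {u : Space L | ‖u‖ ^ 2 ≤ a - ‖x‖ ^ 2 / 4 ∧ δ < |⟪x, u⟫|} := by
        ext u
        simp [ellipsoidBody, hx, le_sub_iff_add_le]
      have e2 : Prod.mk x ⁻¹' ellipsoidBody L 1 a =
          {u : Space L | ‖u‖ ^ 2 ≤ a - ‖x‖ ^ 2 / 4} := by
        ext u
        simp [ellipsoidBody, hx, le_sub_iff_add_le]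
      rw [e1, e2]
      exact h
    · have e1 : Prod.mk x ⁻¹' {p ∈ ellipsoidBody L 1 a | δ < |⟪p.1, p.2⟫|} = ∅ := by
        ext u
        simp [ellipsoidBody, hx]
      rw [e1]
      simp
  have h2 := ENNReal.toReal_mono (ENNReal.mul_ne_top ENNReal.ofReal_ne_top hfin.ne) key
  rwa [ENNReal.toReal_mul, ENNReal.toReal_ofReal (by positivity)] at h2

lemma volume_preimage_smul_prod {L : ℕ} {a b : ℝ} (ha : 0 < a) (hb : 0 < b)
    {D : Set (Space L × Space L)} (hD : MeasurableSet D) :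
    volume.real (Prod.map (a • ·) (b • ·) ⁻¹' D) = (a ^ L)⁻¹ * (b ^ L)⁻¹ * volume.real D := by
  have h := Measure.map_prod_map (volume : Measure (Space L)) (volume : Measure (Space L))
    (measurable_const_smul a) (measurable_const_smul b)
  rw [Measure.map_addHaar_smul _ ha.ne', Measure.map_addHaar_smul _ hb.ne',
    Measure.prod_smul_left, Measure.prod_smul_right, finrank_euclideanSpace_fin,
    abs_of_pos (inv_pos.2 (pow_pos ha L)), abs_of_pos (inv_pos.2 (pow_pos hb L))] at h
  have h1 := congrArg (fun μ => μ D) h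
  simp only [Measure.smul_apply, smul_eq_mul] at h1
  rw [Measure.map_apply ((measurable_const_smul a).prodMap (measurable_const_smul b)) hD] at h1
  rw [Measure.real, Measure.volume_eq_prod, ← h1, ENNReal.toReal_mul, ENNReal.toReal_mul,
    ENNReal.toReal_ofReal (by positivity), ENNReal.toReal_ofReal (by positivity), mul_assoc]
  rfl

lemma measurePreserving_shear (L : ℕ) :
    MeasurePreserving (fun p : Space L × Space L => (p.1, p.2 - (2 : ℝ)⁻¹ • p.1)) volume volume :=
  MeasurePreserving.skew_product (g := fun x y : Space L => y - (2 : ℝ)⁻¹ • x)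
    (MeasurePreserving.id volume) (by fun_prop)
    (Eventually.of_forall fun x => map_sub_right_eq_self volume _)

/-- In the coordinates x and u = y − x/2 the two remaining sides have the same squared length up to
±⟪x, u⟫. Their average gives the ellipsoidal condition as an outer bound for the body; small ⟪x, u⟫
gives an inner one. -/
lemma norm_sq_add_half {L : ℕ} (x y : Space L) :
    ‖y‖ ^ 2 = ‖y - (2 : ℝ)⁻¹ • x‖ ^ 2 + ⟪x, y - (2 : ℝ)⁻¹ • x⟫ + ‖x‖ ^ 2 / 4 ∧
    ‖x - y‖ ^ 2 = ‖y - (2 : ℝ)⁻¹ • x‖ ^ 2 - ⟪x, y - (2 : ℝ)⁻¹ • x⟫ + ‖x‖ ^ 2 / 4 := by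
  simp only [norm_sub_sq_real, inner_sub_right, inner_smul_right, real_inner_self_eq_norm_sq,
    norm_smul, Real.norm_eq_abs, real_inner_comm x y]
  rw [abs_of_pos (by norm_num : (0 : ℝ) < 2⁻¹)]
  constructor <;> ring

/-- For ‖x‖ = t the slice in u has radius at most √(1 − t²/4), so the mass grows with t like a power
of t²(1 − t²/4), which equals 3/4 at t = 1. A linear rescaling turns this into a volume comparison.
-/
lemma volume_pairBody_inter_le {L : ℕ} {s : ℝ} (hs : 0 < s) (hs1 : s < 1) :
    volume.real {p ∈ pairBody L | ‖p.1‖ ≤ s} ≤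
      (s ^ 2 * (1 - s ^ 2 / 4) / (3 / 4)) ^ ((L : ℝ) / 2) *
        volume.real (ellipsoidBody L 1 1) := by
  have hs2 : s ^ 2 < 1 := by nlinarith
  have hq : 0 < 1 - s ^ 2 / 4 := by linarith
  -- Chosen so that the extreme slice ‖x‖ = s goes exactly to the slice ‖x‖ = 1, of squared radius
  -- 3/4.
  set κ := √((3 / 4) / (1 - s ^ 2 / 4)) with hκ
  have hκ0 : 0 < κ := Real.sqrt_pos.2 (by positivity)
  have hκ2 : κ ^ 2 * (1 - s ^ 2 / 4) = 3 / 4 := by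
    rw [hκ, Real.sq_sqrt (by positivity), div_mul_cancel₀ _ hq.ne']
  have hκ1 : κ ^ 2 ≤ 1 := by nlinarith
  have hsub : {p ∈ pairBody L | ‖p.1‖ ≤ s} ⊆
      (fun p : Space L × Space L => (p.1, p.2 - (2 : ℝ)⁻¹ • p.1)) ⁻¹' ellipsoidBody L s 1 := by
    rintro ⟨x, y⟩ ⟨⟨-, h2, h3⟩, h4⟩
    obtain ⟨e1, e2⟩ := norm_sq_add_half x y
    have h2' : ‖y‖ ^ 2 ≤ 1 := pow_le_one₀ (norm_nonneg _) h2
    have h3' : ‖x - y‖ ^ 2 ≤ 1 := pow_le_one₀ (norm_nonneg _) h3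
    refine ⟨h4, ?_⟩
    change ‖y - (2 : ℝ)⁻¹ • x‖ ^ 2 + ‖x‖ ^ 2 / 4 ≤ 1
    linarith
  have hsub2 : ellipsoidBody L s 1 ⊆ Prod.map (s⁻¹ • ·) (κ • ·) ⁻¹' ellipsoidBody L 1 1 := by
    rintro ⟨x, u⟩ ⟨h1, h2⟩
    change ‖x‖ ≤ s at h1
    change ‖u‖ ^ 2 + ‖x‖ ^ 2 / 4 ≤ 1 at h2
    have hx2 : ‖x‖ ^ 2 ≤ s ^ 2 := pow_le_pow_left₀ (norm_nonneg _) h1 2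
    refine ⟨?_, ?_⟩
    · change ‖s⁻¹ • x‖ ≤ 1
      rw [norm_smul, Real.norm_of_nonneg (inv_pos.2 hs).le, inv_mul_le_iff₀ hs, mul_one]
      exact h1
    · change ‖κ • u‖ ^ 2 + ‖s⁻¹ • x‖ ^ 2 / 4 ≤ 1
      rw [norm_smul, norm_smul, mul_pow, mul_pow, Real.norm_of_nonneg (inv_pos.2 hs).le,
        Real.norm_of_nonneg hκ0.le, inv_pow]
      have h5 : κ ^ 2 * ‖u‖ ^ 2 ≤ κ ^ 2 * (1 - ‖x‖ ^ 2 / 4) :=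
        mul_le_mul_of_nonneg_left (by linarith) (sq_nonneg κ)
      set z := (s ^ 2)⁻¹ * ‖x‖ ^ 2 with hz
      have hxz : ‖x‖ ^ 2 = s ^ 2 * z := by
        rw [hz]
        field_simp
      have hz1 : z ≤ 1 := by
        rw [hz, inv_mul_le_iff₀ (by positivity), mul_one]
        exact hx2
      -- This makes κ²(1 − s²z/4) + z/4 increasing in z, so z = 1, where it equals 1, is the worst
      -- case.
      have hκs : κ ^ 2 * s ^ 2 ≤ 1 := mul_le_one₀ hκ1 (sq_nonneg s) hs2.le
      rw [hxz] at h5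
      nlinarith [mul_nonneg (sub_nonneg.2 hz1) (sub_nonneg.2 hκs)]
  have hvol : volume.real ((fun p : Space L × Space L => (p.1, p.2 - (2 : ℝ)⁻¹ • p.1)) ⁻¹'
      ellipsoidBody L s 1) = volume.real (ellipsoidBody L s 1) := by
    rw [Measure.real, (measurePreserving_shear L).measure_preimage
      (measurableSet_ellipsoidBody L s 1).nullMeasurableSet]
    rfl
  have hfin1 : volume (ellipsoidBody L s 1) ≠ ⊤ :=
    (isCompact_ellipsoidBody L s 1).measure_lt_top.ne
  have hvol2 := volume_preimage_smul_prod (inv_pos.2 hs) hκ0 (measurableSet_ellipsoidBody L 1 1)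
  have hE : 0 ≤ volume.real (ellipsoidBody L 1 1) := measureReal_nonneg
  calc _ ≤ volume.real ((fun p : Space L × Space L => (p.1, p.2 - (2 : ℝ)⁻¹ • p.1)) ⁻¹'
          ellipsoidBody L s 1) := by
        refine measureReal_mono hsub ?_
        rw [(measurePreserving_shear L).measure_preimage
          (measurableSet_ellipsoidBody L s 1).nullMeasurableSet]
        exact hfin1
    _ = volume.real (ellipsoidBody L s 1) := hvol
    _ ≤ volume.real (Prod.map (s⁻¹ • ·) (κ • ·) ⁻¹' ellipsoidBody L 1 1) := by
        refine measureReal_mono hsub2 ?_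
        have hc : IsCompact (Prod.map (s⁻¹ • ·) (κ • ·) ⁻¹' ellipsoidBody L 1 1) :=
          ((Homeomorph.smulOfNeZero s⁻¹ (inv_pos.2 hs).ne').prodCongr
            (Homeomorph.smulOfNeZero κ hκ0.ne')).isCompact_preimage.2
            (isCompact_ellipsoidBody L 1 1)
        exact hc.measure_lt_top.ne
    _ = _ := by
        rw [hvol2]
        congr 1
        have h6 : s ^ 2 * (1 - s ^ 2 / 4) / (3 / 4) = (s * κ⁻¹) ^ 2 := by
          rw [← hκ2, mul_pow, inv_pow, mul_div_mul_right _ _ hq.ne', div_eq_mul_inv]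
        rw [h6, ← Real.rpow_natCast (s * κ⁻¹) 2, ← Real.rpow_mul (by positivity)]
        have h7 : ((2 : ℕ) : ℝ) * ((L : ℝ) / 2) = (L : ℝ) := by
          push_cast
          ring
        rw [h7, Real.rpow_natCast, mul_pow, inv_pow, inv_inv, inv_pow]

/-- Lowering the ellipsoidal bound to 1 − δ leaves room for |⟪x, u⟫| ≤ δ, and the remaining points
are a fraction of at most 1/(Lδ²). -/
lemma le_volume_pairBody {L : ℕ} (hL : 0 < L) {δ : ℝ} (hδ : 0 < δ) (hδ' : δ < 3 / 4) :
    (1 - 4 * δ / 3) ^ ((L : ℝ) / 2) * volume.real (ellipsoidBody L 1 1) *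
      (1 - 1 / (L * δ ^ 2)) ≤ volume.real (pairBody L) := by
  have hη0 : 0 < 1 - 4 * δ / 3 := by linarith
  -- η² · 3/4 + 1/4 = 1 − δ, the condition in the worst case ‖x‖ = 1.
  set η := √(1 - 4 * δ / 3) with hη
  have hηpos : 0 < η := Real.sqrt_pos.2 hη0
  have hη2 : η ^ 2 = 1 - 4 * δ / 3 := Real.sq_sqrt hη0.le
  set Q := ellipsoidBody L 1 (1 - δ)
  have hQfin : volume Q ≠ ⊤ := (isCompact_ellipsoidBody L 1 (1 - δ)).measure_lt_top.ne
  have hsub : Prod.map ((1 : ℝ) • ·) (η⁻¹ • ·) ⁻¹' ellipsoidBody L 1 1 ⊆ Q := by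
    rintro ⟨x, u⟩ ⟨h1, h2⟩
    change ‖(1 : ℝ) • x‖ ≤ 1 at h1
    change ‖η⁻¹ • u‖ ^ 2 + ‖(1 : ℝ) • x‖ ^ 2 / 4 ≤ 1 at h2
    rw [one_smul] at h1 h2
    rw [norm_smul, mul_pow, Real.norm_of_nonneg (inv_pos.2 hηpos).le, inv_pow] at h2
    refine ⟨h1, ?_⟩
    change ‖u‖ ^ 2 + ‖x‖ ^ 2 / 4 ≤ 1 - δ
    have hx : ‖x‖ ^ 2 ≤ 1 := pow_le_one₀ (norm_nonneg _) h1
    have h3 : ‖u‖ ^ 2 ≤ η ^ 2 * (1 - ‖x‖ ^ 2 / 4) := by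
      rw [← inv_mul_le_iff₀ (by positivity)]
      linarith
    rw [hη2] at h3
    nlinarith
  have hQ : η ^ L * volume.real (ellipsoidBody L 1 1) ≤ volume.real Q := by
    have h := measureReal_mono hsub hQfin
    rw [volume_preimage_smul_prod one_pos (inv_pos.2 hηpos) (measurableSet_ellipsoidBody L 1 1)]
      at h
    simpa using h
  have hbad := volume_ellipsoidBody_inner_gt_le hL (a := 1 - δ) (by linarith) hδ
  have hbm : MeasurableSet {p ∈ Q | δ < |⟪p.1, p.2⟫|} :=
    (measurableSet_ellipsoidBody L 1 (1 - δ)).inter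
      (measurableSet_lt_abs_inner L δ)
  have hdiff : volume.real (Q \ {p ∈ Q | δ < |⟪p.1, p.2⟫|}) =
      volume.real Q - volume.real {p ∈ Q | δ < |⟪p.1, p.2⟫|} := by
    have hbs : {p ∈ Q | δ < |⟪p.1, p.2⟫|} ⊆ Q := Set.sep_subset _ _
    exact measureReal_sdiff hbs hbm hQfin
  have hsub2 : (fun p : Space L × Space L => (p.1, p.2 - (2 : ℝ)⁻¹ • p.1)) ⁻¹'
      (Q \ {p ∈ Q | δ < |⟪p.1, p.2⟫|}) ⊆ pairBody L := by
    rintro ⟨x, y⟩ ⟨hq, hn⟩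
    have h1 : ‖x‖ ≤ 1 := hq.1
    have h2 : ‖y - (2 : ℝ)⁻¹ • x‖ ^ 2 + ‖x‖ ^ 2 / 4 ≤ 1 - δ := hq.2
    have h3 : |⟪x, y - (2 : ℝ)⁻¹ • x⟫| ≤ δ := by
      by_contra! h
      exact hn ⟨hq, h⟩
    have h4 := abs_le.1 h3
    obtain ⟨e1, e2⟩ := norm_sq_add_half x y
    refine ⟨h1, ?_, ?_⟩
    · exact (sq_le_one_iff₀ (norm_nonneg _)).1 (by linarith)
    · exact (sq_le_one_iff₀ (norm_nonneg (x - y))).1 (by linarith)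
  have hle : volume.real (Q \ {p ∈ Q | δ < |⟪p.1, p.2⟫|}) ≤ volume.real (pairBody L) := by
    have h := measureReal_mono hsub2 (isCompact_pairBody L).measure_lt_top.ne (μ := volume)
    rwa [Measure.real, (measurePreserving_shear L).measure_preimage
      ((measurableSet_ellipsoidBody L 1 (1 - δ)).diff hbm).nullMeasurableSet] at h
  have hpow : (1 - 4 * δ / 3) ^ ((L : ℝ) / 2) = η ^ L := by
    rw [← hη2, ← Real.rpow_natCast η 2, ← Real.rpow_mul hηpos.le]
    have h7 : ((2 : ℕ) : ℝ) * ((L : ℝ) / 2) = (L : ℝ) := by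
      push_cast
      ring
    rw [h7, Real.rpow_natCast]
  rw [hpow]
  rcases le_total 0 (1 - 1 / (L * δ ^ 2)) with hc | hc
  · have := mul_le_mul_of_nonneg_right hQ hc
    linarith
  · have h0 : 0 ≤ η ^ L * volume.real (ellipsoidBody L 1 1) :=
      mul_nonneg (pow_nonneg hηpos.le _) measureReal_nonneg
    exact (mul_nonpos_of_nonneg_of_nonpos h0 hc).trans measureReal_nonneg

lemma volume_ellipsoidBody_pos (L : ℕ) : 0 < volume.real (ellipsoidBody L 1 1) := by
  refine ENNReal.toReal_pos ?_ (isCompact_ellipsoidBody L 1 1).measure_lt_top.ne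
  refine (lt_of_lt_of_le (Metric.measure_ball_pos volume (0 : Space L × Space L)
    (by norm_num : (0:ℝ) < 1 / 2)) (measure_mono ?_)).ne'
  intro p hp
  rw [mem_ball_zero_iff, Prod.norm_def, max_lt_iff] at hp
  refine ⟨by linarith [hp.1], ?_⟩
  nlinarith [norm_nonneg p.1, norm_nonneg p.2]

lemma volume_pairBody_pos (L : ℕ) : 0 < volume.real (pairBody L) := by
  rw [← bodyVolume_two]
  exact bodyVolume_pos 2 L

/-- Both volumes are compared with the same ellipsoidal body; the exponential rate f above is
smaller than the rate g below. -/
lemma tendsto_pairBody_fraction {s : ℝ} (hs : 0 < s) (hs1 : s < 1) :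
    Tendsto (fun L : ℕ => volume.real {p ∈ pairBody L | ‖p.1‖ ≤ s} / volume.real (pairBody L))
      atTop (𝓝 0) := by
  have hs2 : s ^ 2 < 1 := by nlinarith
  set f := s ^ 2 * (1 - s ^ 2 / 4) / (3 / 4) with hf
  have hf0 : 0 < f := by
    have : 0 < 1 - s ^ 2 / 4 := by linarith
    positivity
  have hf1 : f < 1 := by
    rw [hf, div_lt_one (by norm_num)]
    nlinarith [mul_pos (sub_pos.2 hs2) (by linarith : 0 < 3 - s ^ 2)]
  -- Makes g = (1 + f)/2, the midpoint between f and 1.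
  set δ := 3 * (1 - f) / 8 with hδ
  have hδ0 : 0 < δ := by linarith
  have hδ1 : δ < 3 / 4 := by linarith
  set g := 1 - 4 * δ / 3 with hg
  have hg0 : 0 < g := by linarith
  have hfg : f / g < 1 := by
    rw [div_lt_one hg0]
    linarith
  have hq : 0 ≤ f / g := by positivity
  have h1 : Tendsto (fun L : ℕ => (√(f / g)) ^ L) atTop (𝓝 0) :=
    tendsto_pow_atTop_nhds_zero_of_lt_one (Real.sqrt_nonneg _)
      ((Real.sqrt_lt' one_pos).2 (by simpa using hfg))
  have h2 : Tendsto (fun L : ℕ => 1 - 1 / ((L : ℝ) * δ ^ 2)) atTop (𝓝 1) := by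
    have : Tendsto (fun L : ℕ => 1 / ((L : ℝ) * δ ^ 2)) atTop (𝓝 0) :=
      tendsto_const_nhds.div_atTop
        (tendsto_natCast_atTop_atTop.atTop_mul_const (by positivity))
    simpa using this.const_sub 1
  have h3 := h1.div h2 one_ne_zero
  rw [zero_div] at h3
  refine tendsto_of_tendsto_of_tendsto_of_le_of_le' tendsto_const_nhds h3
    (Eventually.of_forall fun L => div_nonneg measureReal_nonneg measureReal_nonneg) ?_
  filter_upwards [h2.eventually_const_lt zero_lt_one, eventually_gt_atTop 0] with L hL hL0
  have hE := volume_ellipsoidBody_pos L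
  have hup := volume_pairBody_inter_le (L := L) hs hs1
  have hlo := le_volume_pairBody hL0 hδ0 hδ1
  have hgp : 0 < g ^ ((L : ℝ) / 2) := Real.rpow_pos_of_pos hg0 _
  have hpow : (√(f / g)) ^ L = f ^ ((L : ℝ) / 2) / g ^ ((L : ℝ) / 2) := by
    rw [← Real.div_rpow hf0.le hg0.le, Real.sqrt_eq_rpow, ← Real.rpow_natCast,
      ← Real.rpow_mul hq]
    congr 1
    ring
  have hden : 0 < g ^ ((L : ℝ) / 2) * volume.real (ellipsoidBody L 1 1) *
      (1 - 1 / (L * δ ^ 2)) := mul_pos (mul_pos hgp hE) hL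
  calc _ ≤ f ^ ((L : ℝ) / 2) * volume.real (ellipsoidBody L 1 1) /
        (g ^ ((L : ℝ) / 2) * volume.real (ellipsoidBody L 1 1) * (1 - 1 / (L * δ ^ 2))) :=
        div_le_div₀ (mul_nonneg (Real.rpow_nonneg hf0.le _) hE.le) hup hden hlo
    _ = _ := by
        simp only [Pi.div_apply]
        rw [hpow]
        field_simp

lemma sq_mul_le_setIntegral {E : Type*} [MeasurableSpace E] {μ : Measure E} {B : Set E}
    {f : E → ℝ} (hB : MeasurableSet B) (hfin : μ B ≠ ⊤) (hf : Measurable f)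
    (hint : IntegrableOn (fun x => f x ^ 2) B μ) {s : ℝ} (hs : 0 ≤ s) :
    s ^ 2 * (μ.real B - μ.real {x ∈ B | f x ≤ s}) ≤ ∫ x in B, f x ^ 2 ∂μ := by
  have hm : MeasurableSet {x ∈ B | f x ≤ s} := hB.inter (measurableSet_le hf measurable_const)
  have hsub : {x ∈ B | f x ≤ s} ⊆ B := Set.sep_subset _ _
  have hdfin : μ (B \ {x ∈ B | f x ≤ s}) ≠ ⊤ :=
    ((measure_mono Set.sdiff_subset).trans_lt hfin.lt_top).ne
  rw [← measureReal_sdiff hsub hm hfin]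
  calc _ = ∫ _ in B \ {x ∈ B | f x ≤ s}, s ^ 2 ∂μ := by
        rw [setIntegral_const, smul_eq_mul, mul_comm]
    _ ≤ ∫ x in B \ {x ∈ B | f x ≤ s}, f x ^ 2 ∂μ :=
        setIntegral_mono_on (integrableOn_const hdfin) (hint.mono_set Set.sdiff_subset)
          (hB.diff hm) fun x hx => by
            have : s < f x := by
              by_contra! h
              exact hx.2 ⟨hx.1, h⟩
            exact pow_le_pow_left₀ hs this.le 2
    _ ≤ _ := setIntegral_mono_set hint (Eventually.of_forall fun _ => sq_nonneg _)
        Set.sdiff_subset.eventuallyLE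

lemma tendsto_one_of_sq_mul_le {u : ℕ → ℝ} (h1 : ∀ L, u L ≤ 1)
    (h2 : ∀ s : ℝ, 0 < s → s < 1 → ∃ v : ℕ → ℝ, Tendsto v atTop (𝓝 0) ∧
      ∀ L, s ^ 2 * (1 - v L) ≤ u L) : Tendsto u atTop (𝓝 1) := by
  rw [tendsto_order]
  refine ⟨fun a ha => ?_, fun a ha => Eventually.of_forall fun L => (h1 L).trans_lt ha⟩
  -- The positive part allows √b as threshold, so that its square lies strictly between `a` and 1.
  set b := (max a 0 + 1) / 2 with hb
  have hm : max a 0 < 1 := max_lt ha one_pos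
  have hm0 : 0 ≤ max a 0 := le_max_right _ _
  have hb0 : 0 < b := by linarith
  have hb1 : b < 1 := by linarith
  have hab : a < b := by linarith [le_max_left a 0]
  obtain ⟨v, hv, hle⟩ := h2 (√b) (Real.sqrt_pos.2 hb0)
    ((Real.sqrt_lt' one_pos).2 (by simpa using hb1))
  have hlim : Tendsto (fun L => √b ^ 2 * (1 - v L)) atTop (𝓝 b) := by
    rw [Real.sq_sqrt hb0.le]
    simpa using (hv.const_sub 1).const_mul b
  filter_upwards [hlim.eventually_const_lt hab] with L hL
  exact hL.trans_le (hle L)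

lemma tendsto_bodyMoment_div :
    Tendsto (fun L : ℕ => bodyMoment 2 L 0 1 / bodyVolume 2 L) atTop (𝓝 1) := by
  refine tendsto_one_of_sq_mul_le
    (fun L => (div_le_one (bodyVolume_pos 2 L)).2 (bodyMoment_le 2 L 0 1))
    fun s hs hs1 => ⟨_, tendsto_pairBody_fraction hs hs1, fun L => ?_⟩
  have hV := volume_pairBody_pos L
  rw [bodyMoment_two L (by decide), bodyVolume_two, le_div_iff₀ hV, mul_assoc, sub_mul, one_mul,
    div_mul_cancel₀ _ hV.ne']
  refine sq_mul_le_setIntegral (measurableSet_pairBody L)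
    (isCompact_pairBody L).measure_lt_top.ne (by fun_prop) ?_ hs.le
  exact Continuous.continuousOn (by fun_prop) |>.integrableOn_compact (isCompact_pairBody L)

lemma integral_ball_pos {L : ℕ} (hL : 0 < L) :
    0 < ∫ x in Metric.closedBall (0 : Space L) 1, ‖x‖ ^ 2 := by
  have h := sq_mul_le_setIntegral (μ := volume) (B := Metric.closedBall (0 : Space L) 1)
    (f := fun x => ‖x‖) measurableSet_closedBall measure_closedBall_lt_top.ne measurable_norm
    (Continuous.continuousOn (by fun_prop) |>.integrableOn_compact (isCompact_closedBall 0 1))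
    (s := 1 / 2) (by norm_num)
  refine lt_of_lt_of_le (mul_pos (by norm_num) (sub_pos.2 ?_)) h
  have h2 : {x ∈ Metric.closedBall (0 : Space L) 1 | ‖x‖ ≤ 1 / 2} ⊆
      Metric.closedBall (0 : Space L) (1 / 2) := fun x hx => by
    rw [mem_closedBall_zero_iff]
    exact hx.2
  refine lt_of_le_of_lt (measureReal_mono h2 measure_closedBall_lt_top.ne) ?_
  rw [Measure.real, Measure.addHaar_closedBall' _ _ (by norm_num), finrank_euclideanSpace_fin,
    ENNReal.toReal_mul, ENNReal.toReal_ofReal (by positivity)]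
  have h3 : (1 / 2 : ℝ) ^ L < 1 := pow_lt_one₀ (by norm_num) (by norm_num) hL.ne'
  have h4 := unitBallVolume_pos L
  exact (mul_lt_mul_of_pos_right h3 h4).trans_eq (one_mul _)

lemma tendsto_integral_ball_div :
    Tendsto (fun L : ℕ => (∫ x in Metric.closedBall (0 : Space L) 1, ‖x‖ ^ 2) /
      unitBallVolume L) atTop (𝓝 1) := by
  refine tendsto_one_of_sq_mul_le (fun L => ?_) fun s hs hs1 =>
    ⟨_, tendsto_pow_atTop_nhds_zero_of_lt_one hs.le hs1, fun L => ?_⟩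
  · rw [div_le_one (unitBallVolume_pos L)]
    rcases Nat.eq_zero_or_pos L with rfl | hL
    · have h0 : ∀ x : Space 0, ‖x‖ ^ 2 = 0 := fun x => by
        rw [Subsingleton.elim x 0, norm_zero]
        norm_num
      simp only [h0, integral_zero]
      exact (unitBallVolume_pos 0).le
    · rw [← bodyMoment_one L (i := 0) (j := 1) (by decide), ← bodyVolume_one]
      exact bodyMoment_le 1 L 0 1
  · have h := sq_mul_le_setIntegral (μ := volume) (B := Metric.closedBall (0 : Space L) 1)
      (f := fun x => ‖x‖) measurableSet_closedBall measure_closedBall_lt_top.ne measurable_norm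
      (Continuous.continuousOn (by fun_prop) |>.integrableOn_compact (isCompact_closedBall 0 1))
      hs.le
    rw [le_div_iff₀ (unitBallVolume_pos L), mul_assoc]
    refine le_trans (mul_le_mul_of_nonneg_left ?_ (sq_nonneg s)) h
    have h2 : {x ∈ Metric.closedBall (0 : Space L) 1 | ‖x‖ ≤ s} ⊆
        Metric.closedBall (0 : Space L) s := fun x hx => by
      rw [mem_closedBall_zero_iff]
      exact hx.2
    have h3 := measureReal_mono h2 measure_closedBall_lt_top.ne (μ := volume)
    have h4 : volume.real (Metric.closedBall (0 : Space L) s) = s ^ L * unitBallVolume L := by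
      rw [Measure.real, Measure.addHaar_closedBall' _ _ hs.le, finrank_euclideanSpace_fin,
        ENNReal.toReal_mul, ENNReal.toReal_ofReal (by positivity)]
      rfl
    have h5 : volume.real (Metric.closedBall (0 : Space L) 1) = unitBallVolume L := rfl
    rw [h5]
    linarith

/-- The limit of the distortion quotients for three descriptions. -/
def tripleConstant (L : ℕ) : ℝ :=
  bodyMoment 2 L 0 1 / bodyVolume 2 L *
    (unitBallVolume L / ∫ x in Metric.closedBall (0 : Space L) 1, ‖x‖ ^ 2)

lemma tendsto_tripleConstant : Tendsto tripleConstant atTop (𝓝 1) := by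
  have h := tendsto_bodyMoment_div.mul (tendsto_integral_ball_div.inv₀ one_ne_zero)
  rw [inv_one, mul_one] at h
  refine h.congr fun L => ?_
  rw [inv_div, tripleConstant]

/-! ### The limits for two and three descriptions. -/

theorem tendsto_two {L : ℕ} (hL : 0 < L) (M : Submodule ℤ (Space L)) [DiscreteTopology M]
    [IsZLattice ℝ M] (d : ℕ → AsymmetricDesign (1 + 1) L) (h : HighResolution M d) :
    (∀ i j : Fin (1 + 1), i ≠ j →
      Tendsto (fun n => (d n).pairDistortion i j / (d n).predictedDistortion) atTop (𝓝 1)) ∧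
    Tendsto (fun n => (d n).ballVolume / (d n).predictedBallVolume) atTop (𝓝 1) := by
  obtain ⟨F, ρ, hs⟩ := h.exists_smallTiles_two hL
  refine ⟨fun i j hij => ?_, hs.tendsto_ballVolume one_pos hL⟩
  have h1 := hs.tendsto_pairDistortion one_pos hL i j
  rwa [bodyMoment_one L hij, bodyVolume_one, div_mul_div_cancel₀ (unitBallVolume_pos L).ne',
    div_self (integral_ball_pos hL).ne'] at h1

theorem tendsto_three {L : ℕ} (hL : 0 < L) (M : Submodule ℤ (Space L)) [DiscreteTopology M]
    [IsZLattice ℝ M] (d : ℕ → AsymmetricDesign (2 + 1) L) (h : HighResolution M d)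
    (hfill : FillsBalls d) :
    (∀ i j : Fin (2 + 1), i ≠ j →
      Tendsto (fun n => (d n).pairDistortion i j / (d n).predictedDistortion) atTop
        (𝓝 (tripleConstant L))) ∧
    Tendsto (fun n => (d n).ballVolume / (d n).predictedBallVolume) atTop (𝓝 1) := by
  obtain ⟨F, ρ, hs⟩ := h.exists_smallTiles_three hfill hL
  refine ⟨fun i j hij => ?_, hs.tendsto_ballVolume two_pos hL⟩
  have h1 := hs.tendsto_pairDistortion two_pos hL i j
  rwa [bodyMoment_two L hij, ← bodyMoment_two L (i := 0) (j := 1) (by decide)] at h1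

end MDLVQ

end

theorem proposition6p1 :
    -- two descriptions, every dimension
    (∀ L : ℕ, 0 < L →
      ∀ (M : Submodule ℤ (MDLVQ.Space L)) [DiscreteTopology M] [IsZLattice ℝ M]
        (d : ℕ → MDLVQ.AsymmetricDesign 2 L), MDLVQ.HighResolution M d →
        (∀ i j : Fin 2, i ≠ j →
          Tendsto (fun n => (d n).pairDistortion i j / (d n).predictedDistortion)
            atTop (𝓝 1)) ∧
        Tendsto (fun n => (d n).ballVolume / (d n).predictedBallVolume) atTop (𝓝 1)) ∧
    -- three descriptions, dimension tending to infinity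
    (∃ c : ℕ → ℝ, Tendsto c atTop (𝓝 1) ∧
      ∀ L : ℕ, 0 < L →
        ∀ (M : Submodule ℤ (MDLVQ.Space L)) [DiscreteTopology M] [IsZLattice ℝ M]
          (d : ℕ → MDLVQ.AsymmetricDesign 3 L), MDLVQ.HighResolution M d →
          MDLVQ.FillsBalls d →
          (∀ i j : Fin 3, i ≠ j →
            Tendsto (fun n => (d n).pairDistortion i j / (d n).predictedDistortion)
              atTop (𝓝 (c L))) ∧
          Tendsto (fun n => (d n).ballVolume / (d n).predictedBallVolume) atTop (𝓝 1)) := by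
  exact ⟨fun L hL M _ _ d h => MDLVQ.tendsto_two hL M d h,
    MDLVQ.tripleConstant, MDLVQ.tendsto_tripleConstant,
    fun L hL M _ _ d h hfill => MDLVQ.tendsto_three hL M d h hfill⟩
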